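/- **Setting.** Let $S$ be a measurable space of states, $A$ a set of actions, and let $\mu$ be a $\sigma$-finite reference measure on the space $S\times\mathbb R$ of pairs (next state, reward). Let $\Gamma$ be a measurable space of parameters with a prior probability measure $\pi$. For every $(s,a)\in S\times A$ let $p(\cdot\mid s,a,\theta)$, $\theta\in\Gamma$, be probability densities with respect to $\mu$, jointly measurable in the parameter and the outcome, and let $q(\cdot\mid s,a)$ be the true probability density with respect to $\mu$. Fix $(s,a)$ and write $p_\theta=p(\cdot\mid s,a,\theta)$ and $q=q(\cdot\mid s,a)$; the quantities below depend on $(s,a)$. Let $X=(X_1,\dots,X_n)$, $n\ge 1$, be i.i.d. samples from $q$. The posterior is $$\pi_n(B\mid X)=\frac{\int_B\prod_{i=1}^n p_\theta(X_i)\,d\pi(\theta)}{\int_\Gamma\prod_{i=1}^n p_\theta(X_i)\,d\pi(\theta)}.$$ Define the prior-mass radius $$d_\pi=\inf\{d\in\mathbb R: d\ge-\ln\pi(\{\theta\in\Gamma: D_{KL}(q\|p_\theta)\le d\})\}\in[0,\infty],$$ with $\inf\varnothing=\infty$. For $G\subseteq\Gamma$ let $r_{ub}(G)=\int\sup_{\theta\in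 G}p_\theta\,d\mu-1$ (the supremum over $\varnothing$ being $0$), and for $t\in[0,1]$ define the critical upper-bracketing radius $$\varepsilon_{upper,n}(t)=\frac1n\inf_{\{\Gamma_j\}}\ln\sum_j\pi(\Gamma_j)^{t}\,(1+r_{ub}(\Gamma_j))^n\in[0,\infty],$$ where the infimum is over all countable coverings $\{\Gamma_j\}$ of $\Gamma$ by measurable sets (with $0^0=1$ and $0\cdot\infty=0$). For $\eta\ge1$ and $\rho\in(0,1)$ let $$\varepsilon_n=\Big(1+\frac1n\Big)\eta\,d_\pi+(\eta-\rho)\,\varepsilon_{upper,n}\Big(\frac{\eta-1}{\eta-\rho}\Big).$$ **Proposition 4.2.** Let $\rho=\frac12$. For all $n\ge 1$, $\eta\ge1$, all states $s$ and actions $a$, all $h\ge0$ and $\delta\in(0,1)$ such that $2\varepsilon_n+(4\eta-2)h>0$, with probability at least $1-\delta$ over $X$, $$\pi_n\Big(\Big\{\theta\in\Gamma:\ \tfrac12\|p_\theta-q\|_1^2\ \ge\ \frac{2\varepsilon_n+(4\eta-2)h}{\delta/4}\Big\}\,\Big|\,X\Big)\ \le\ \frac1{1+e^{nh}},$$ where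 $\|p_\theta-q\|_1=\int|p_\theta-q|\,d\mu$. -/

import Mathlib

open MeasureTheory InformationTheory
open scoped ENNReal NNReal

noncomputable section

/-! Bayesian density estimation with a parametrised family of densities
`p : Γ → 𝒳 → ℝ≥0` with respect to a reference measure `μ` on the sample space `𝒳`,
a prior `π` on the parameter space `Γ`, and a true density `q : 𝒳 → ℝ≥0`. -/
namespace BayesDensity

variable {Γ 𝒳 : Type*} [MeasurableSpace 𝒳]

/-- `f` is a probability density with respect to `μ`. -/
def IsDensity (μ : Measure 𝒳) (f : 𝒳 → ℝ≥0) : Prop :=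
  Measurable f ∧ ∫⁻ x, (f x : ℝ≥0∞) ∂μ = 1

/-- The distribution with density `f` with respect to `μ`. -/
def law (μ : Measure 𝒳) (f : 𝒳 → ℝ≥0) : Measure 𝒳 :=
  μ.withDensity fun x => (f x : ℝ≥0∞)

/-- The Kullback-Leibler divergence `KL(q ‖ f) = ∫ q ln (q / f) dμ`, possibly infinite. -/
def kl (μ : Measure 𝒳) (q f : 𝒳 → ℝ≥0) : ℝ≥0∞ :=
  klDiv (law μ q) (law μ f)

/-- The `L¹` distance `‖f - q‖₁` with respect to `μ`. -/
def l1Dist (μ : Measure 𝒳) (f q : 𝒳 → ℝ≥0) : ℝ :=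
  ∫ x, |(f x : ℝ) - (q x : ℝ)| ∂μ

/-- The upper-bracketing radius `r_ub(G) = ∫ sup_{θ ∈ G} p(x|θ) dμ(x) - 1` of a set `G` of
parameters. The supremum over the empty set is `0`, so `r_ub(∅) = -1`. -/
def upperBracketingRadius (μ : Measure 𝒳) (p : Γ → 𝒳 → ℝ≥0) (G : Set Γ) : EReal :=
  ((∫⁻ x, ⨆ θ ∈ G, (p θ x : ℝ≥0∞) ∂μ : ℝ≥0∞) : EReal) - 1

theorem one_add_upperBracketingRadius (μ : Measure 𝒳) (p : Γ → 𝒳 → ℝ≥0) (G : Set Γ) :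
    (1 + upperBracketingRadius μ p G).toENNReal = ∫⁻ x, ⨆ θ ∈ G, (p θ x : ℝ≥0∞) ∂μ := by
  have h : ∀ a : EReal, 1 + (a - 1) = a := by
    intro a
    induction a with
    | bot => rfl
    | top => rfl
    | coe a => exact_mod_cast (by ring : (1 : ℝ) + (a - 1) = a)
  rw [upperBracketingRadius, h, EReal.toENNReal_coe]

variable [MeasurableSpace Γ]

/-- The prior-mass radius `d_π = inf {d : d ≥ - ln π {θ : KL(q ‖ p_θ) ≤ d}}`, equal to `+∞`
when no real `d` qualifies. -/
def priorMassRadius (μ : Measure 𝒳) (π : Measure Γ) (p : Γ → 𝒳 → ℝ≥0) (q : 𝒳 → ℝ≥0) : EReal :=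
  ⨅ (d : ℝ) (_ : (d : EReal) ≥ -ENNReal.log (π {θ | (kl μ q (p θ) : EReal) ≤ (d : EReal)})),
    (d : EReal)

/-- The critical upper-bracketing radius with exponent `s`,
`ε_{upper,n}(s) = (1/n) inf ln ∑ⱼ π(Γⱼ)^s (1 + r_ub(Γⱼ))^n`, the infimum being over all countable
coverings `(Γⱼ)` of `Γ` by measurable sets. Finite coverings are included: for `n ≥ 1` the
empty set contributes `0` to the sum, as `1 + r_ub(∅) = 0`. -/
def upperRadius (μ : Measure 𝒳) (π : Measure Γ) (p : Γ → 𝒳 → ℝ≥0) (n : ℕ) (s : ℝ) : EReal :=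
  ⨅ (G : ℕ → Set Γ) (_ : ∀ j, MeasurableSet (G j)) (_ : ⋃ j, G j = Set.univ),
    (((1 / n : ℝ)) : EReal) *
      ENNReal.log (∑' j, π (G j) ^ s * (1 + upperBracketingRadius μ p (G j)).toENNReal ^ n)

/-- `ε_n = (1 + 1/n) η d_π + (η - ρ) ε_{upper,n}((η - 1)/(η - ρ))`. -/
def epsilonN (μ : Measure 𝒳) (π : Measure Γ) (p : Γ → 𝒳 → ℝ≥0) (q : 𝒳 → ℝ≥0)
    (n : ℕ) (η ρ : ℝ) : EReal :=
  (((1 + 1 / n) * η : ℝ) : EReal) * priorMassRadius μ π p q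
    + ((η - ρ : ℝ) : EReal) * upperRadius μ π p n ((η - 1) / (η - ρ))

/-- The threshold `(2 ε_n + (4η - 2) h) / (δ / 4)`, where `ρ = 1/2` in `ε_n`. -/
def threshold (μ : Measure 𝒳) (π : Measure Γ) (p : Γ → 𝒳 → ℝ≥0) (q : 𝒳 → ℝ≥0)
    (n : ℕ) (η h δ : ℝ) : EReal :=
  (2 * epsilonN μ π p q n η (1 / 2) + (((4 * η - 2) * h : ℝ) : EReal)) / ((δ / 4 : ℝ) : EReal)

/-- The likelihood of the sample `X` under the parameter `θ`. -/
def likelihood (p : Γ → 𝒳 → ℝ≥0) {n : ℕ} (X : Fin n → 𝒳) (θ : Γ) : ℝ≥0∞ :=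
  ∏ i, (p θ (X i) : ℝ≥0∞)

/-- The Bayesian posterior given the sample `X`: its density with respect to the prior is
the likelihood divided by the prior-averaged likelihood. -/
def posterior (π : Measure Γ) (p : Γ → 𝒳 → ℝ≥0) {n : ℕ} (X : Fin n → 𝒳) : Measure Γ :=
  π.withDensity fun θ => likelihood p X θ / ∫⁻ θ', likelihood p X θ' ∂π

end BayesDensity

end

/-! Let L(θ) = ∏ p_θ(X_i)/q(X_i), let V = ∫ L dπ be the evidence, and let B be the set of parameters
whose L¹ distance reaches the threshold. The posterior is tilted by e^{nh} on B, giving a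
probability w with prior density f. If the posterior mass of B exceeds 1/(1+e^{nh}), then w(B)
exceeds 1/2, so it suffices to bound the expectation of w(B) over the sample.

For e = nτ·1_B the pointwise identity e = log(√L e^e / f) + η(log f − log L) + (η − 1/2)(log L − t
log f), with (η − 1/2)t = η − 1, splits the task in three. The first term integrates to something
controlled by ∫ √L e^e dπ, whose expectation is at most 1, because on B the Hellinger affinity to
the power n cancels e^{nτ}. The second is at most η(nh − log V), and Jensen's inequality on the
prior conditioned to a Kullback-Leibler ball gives E[−log V] ≤ (n+1)d. The third is controlled by
the bracketing sum Σ π(Γ_j)^t ∏ U_j(X_i), where U_j dominates the ratios on the cell Γ_j. Every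
logarithm is replaced by log x ≤ x − 1, so the random terms are linear and the expectation over X
can be taken directly.

`tilted_posterior_integral_le` is the deterministic inequality, `exists_neg_log_evidence_le` handles
the evidence, `prob_posterior_gt_le` averages over the sample, and `l1Dist_sq_le` converts L¹
distance to affinity. Letting the radii decrease to their infima ends the proof. -/

namespace BayesDensity

/-! ### Deterministic inequalities for a tilted posterior -/

section Tilting

theorem ennreal_div_mul_le (a b : ℝ≥0∞) : a / b * b ≤ a := by
  rw [mul_comm]; exact ENNReal.mul_div_le

theorem tsum_indicator_eq_of_mem {Γ : Type*} {D : ℕ → Set Γ} (hD : Pairwise (Function.onFun Disjoint D))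
    (g : ℕ → Γ → ℝ≥0∞) {θ : Γ} {j : ℕ} (hj : θ ∈ D j) :
    ∑' i, (D i).indicator (g i) θ = g j θ := by
  rw [tsum_eq_single j, Set.indicator_of_mem hj]
  intro i hi
  exact Set.indicator_of_notMem (fun h => Set.disjoint_left.1 (hD hi) h hj) _

variable {Γ : Type*} [MeasurableSpace Γ]

theorem lintegral_tsum_indicator (w : Measure Γ) {D : ℕ → Set Γ}
    (hDm : ∀ j, MeasurableSet (D j)) {g : ℕ → Γ → ℝ≥0∞} (hg : ∀ j, Measurable (g j)) :
    ∫⁻ θ, ∑' j, (D j).indicator (g j) θ ∂w = ∑' j, ∫⁻ θ in D j, g j θ ∂w := by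
  rw [lintegral_tsum fun j => ((hg j).indicator (hDm j)).aemeasurable]
  exact tsum_congr fun j => lintegral_indicator (hDm j) _

/-- Change of measure back to the prior. Only an inequality holds, since the mass of g where F
vanishes can be lost. -/
theorem lintegral_mul_inv_withDensity_le (π : Measure Γ) {F g : Γ → ℝ≥0∞} (hF : Measurable F)
    (hg : Measurable g) :
    ∫⁻ θ, g θ * (F θ)⁻¹ ∂(π.withDensity F) ≤ ∫⁻ θ, g θ ∂π := by
  have hm : Measurable fun θ => g θ * (F θ)⁻¹ := hg.mul hF.inv
  rw [lintegral_withDensity_eq_lintegral_mul _ hF hm]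
  refine lintegral_mono fun θ => ?_
  calc F θ * (g θ * (F θ)⁻¹) = g θ * (F θ * (F θ)⁻¹) := by ring
    _ ≤ g θ * 1 := by gcongr; exact ENNReal.mul_inv_le_one _
    _ = g θ := mul_one _

/-- Gibbs-type inequality for the tilted posterior `w` whose density with respect to the prior is
proportional to `e^{b} L`. -/
theorem tilted_posterior_integral_le (π : Measure Γ) [IsProbabilityMeasure π]
    {L : Γ → ℝ≥0} (hL : Measurable L) {b e : Γ → ℝ} (hb : Measurable b) (he : Measurable e)
    {h V Z : ℝ} (hbh : ∀ θ, b θ ≤ h) (hV : 0 < V) (hVZ : V ≤ Z)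
    [hw : IsProbabilityMeasure (π.withDensity fun θ => ENNReal.ofReal (Real.exp (b θ) * L θ / Z))]
    (hei : Integrable e (π.withDensity fun θ => ENNReal.ofReal (Real.exp (b θ) * L θ / Z)))
    {D : ℕ → Set Γ} (hDm : ∀ j, MeasurableSet (D j)) (hD : Pairwise (Function.onFun Disjoint D))
    (hDU : ⋃ j, D j = Set.univ) {U : ℕ → ℝ≥0∞}
    (hLU : ∀ j, ∀ᵐ θ ∂π.restrict (D j), (L θ : ℝ≥0∞) ≤ U j) {η t : ℝ} (hη : 1 ≤ η)
    (ht0 : 0 ≤ t) (ht1 : t ≤ 1) (hηt : (η - 1 / 2) * t = η - 1)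
    (hU : ∑' j, π (D j) ^ t * U j ≠ ∞)
    (hM : ∫⁻ θ, ENNReal.ofReal (√(L θ) * Real.exp (e θ)) ∂π ≠ ∞) (k : ℝ) :
    ∫ θ, e θ ∂(π.withDensity fun θ => ENNReal.ofReal (Real.exp (b θ) * L θ / Z)) ≤
      ((∫⁻ θ, ENNReal.ofReal (√(L θ) * Real.exp (e θ)) ∂π).toReal - 1)
        + η * (h - Real.log V)
        + (η - 1 / 2) * ((∑' j, π (D j) ^ t * U j).toReal / Real.exp k - 1 + k) := by
  have hZ : 0 < Z := hV.trans_le hVZ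
  set f : Γ → ℝ := fun θ => Real.exp (b θ) * L θ / Z with hf
  have hfm : Measurable f := by fun_prop
  set F : Γ → ℝ≥0∞ := fun θ => ENNReal.ofReal (f θ) with hF
  have hFm : Measurable F := hfm.ennreal_ofReal
  set w := π.withDensity F with hwdef
  set M := ∫⁻ θ, ENNReal.ofReal (√(L θ) * Real.exp (e θ)) ∂π with hMdef
  set US := ∑' j, π (D j) ^ t * U j with hUS
  -- The three arguments of log x ≤ x − 1. Their w-integrals are at most M, US and 1. G1 compares
  -- the bracketing weight of the cell of θ with its w-mass; G2 compares the density of w with its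
  -- average over the cell.
  set F1 : Γ → ℝ≥0∞ := fun θ => ENNReal.ofReal (√(L θ) * Real.exp (e θ)) * (F θ)⁻¹ with hF1
  set G1 : Γ → ℝ≥0∞ := fun θ =>
    ∑' j, (D j).indicator (fun _ => π (D j) ^ t * U j / w (D j)) θ with hG1
  set G2 : Γ → ℝ≥0∞ := fun θ =>
    ∑' j, (D j).indicator (fun θ => w (D j) / π (D j) * (F θ)⁻¹) θ with hG2
  have hF1m : Measurable F1 := by
    have : Measurable fun θ => √(L θ : ℝ) := by fun_prop
    exact (by fun_prop : Measurable fun θ => √(L θ : ℝ) * Real.exp (e θ)).ennreal_ofReal.mul hFm.inv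
  have hG1m : Measurable G1 :=
    Measurable.tsum fun j => measurable_const.indicator (hDm j)
  have hG2m : Measurable G2 :=
    Measurable.tsum fun j => (measurable_const.mul hFm.inv).indicator (hDm j)
  have iF1 : ∫⁻ θ, F1 θ ∂w ≤ M := by
    have : Measurable fun θ => √(L θ : ℝ) := by fun_prop
    exact lintegral_mul_inv_withDensity_le π hFm
      (by fun_prop : Measurable fun θ => √(L θ : ℝ) * Real.exp (e θ)).ennreal_ofReal
  have iG1 : ∫⁻ θ, G1 θ ∂w ≤ US := by
    rw [hG1, lintegral_tsum_indicator w hDm fun j => measurable_const]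
    refine ENNReal.tsum_le_tsum fun j => ?_
    rw [setLIntegral_const]
    exact ennreal_div_mul_le _ _
  have iG2 : ∫⁻ θ, G2 θ ∂w ≤ 1 := by
    have hm : ∀ j, Measurable fun θ => w (D j) / π (D j) * (F θ)⁻¹ :=
      fun j => measurable_const.mul hFm.inv
    rw [hG2, lintegral_tsum_indicator w hDm hm]
    calc _ ≤ ∑' j, w (D j) := by
          refine ENNReal.tsum_le_tsum fun j => ?_
          have hFi : Measurable fun θ => (F θ)⁻¹ := hFm.inv
          rw [lintegral_const_mul _ hFi, hwdef, restrict_withDensity (hDm j)]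
          have := lintegral_mul_inv_withDensity_le (π.restrict (D j)) hFm
            (measurable_const (a := (1 : ℝ≥0∞)))
          simp only [one_mul, lintegral_one, Measure.restrict_apply_univ] at this
          calc _ ≤ (π.withDensity F) (D j) / π (D j) * π (D j) := by gcongr
            _ ≤ _ := ennreal_div_mul_le _ _
      _ = w (⋃ j, D j) := (measure_iUnion hD hDm).symm
      _ = 1 := by rw [hDU]; exact measure_univ
  have tF1 : ∀ᵐ θ ∂w, F1 θ < ∞ := ae_lt_top hF1m (ne_top_of_le_ne_top hM iF1)
  have tG1 : ∀ᵐ θ ∂w, G1 θ < ∞ := ae_lt_top hG1m (ne_top_of_le_ne_top hU iG1)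
  have tG2 : ∀ᵐ θ ∂w, G2 θ < ∞ := ae_lt_top hG2m (ne_top_of_le_ne_top ENNReal.one_ne_top iG2)
  have hac : w ≪ π := withDensity_absolutelyContinuous _ _
  have hLpos : ∀ᵐ θ ∂w, 0 < L θ := by
    rw [hwdef, ae_withDensity_iff hFm]
    refine Filter.Eventually.of_forall fun θ hθ => pos_iff_ne_zero.2 fun h0 => hθ ?_
    simp [hF, hf, h0]
  have hLUw : ∀ᵐ θ ∂w, ∀ j, θ ∈ D j → (L θ : ℝ≥0∞) ≤ U j := by
    refine ae_all_iff.2 fun j => hac.ae_le ?_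
    exact (ae_restrict_iff' (hDm j)).1 (hLU j)
  -- Cells of zero w-mass are discarded, so that the logarithms of both cell masses are taken at
  -- positive numbers.
  have hwj : ∀ᵐ θ ∂w, ∀ j, θ ∈ D j → w (D j) ≠ 0 := by
    refine ae_all_iff.2 fun j => ?_
    by_cases h0 : w (D j) = 0
    · filter_upwards [measure_eq_zero_iff_ae_notMem.1 h0] with θ hθ hθ'
      exact absurd hθ' hθ
    · exact Filter.Eventually.of_forall fun _ _ => h0
  have key : ∀ᵐ θ ∂w, e θ ≤ ((F1 θ).toReal - 1) + η * (h - Real.log V)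
      + (η - 1 / 2) * (((G1 θ).toReal / Real.exp k - 1 + k) + t * ((G2 θ).toReal - 1)) := by
    filter_upwards [hLpos, hLUw, hwj] with θ hLθ hUθ hwθ
    obtain ⟨j, hj⟩ := Set.mem_iUnion.1 (hDU ▸ Set.mem_univ θ : θ ∈ ⋃ j, D j)
    have e1 : G1 θ = π (D j) ^ t * U j / w (D j) := tsum_indicator_eq_of_mem hD _ hj
    have e2 : G2 θ = w (D j) / π (D j) * (F θ)⁻¹ :=
      tsum_indicator_eq_of_mem hD (fun j θ => w (D j) / π (D j) * (F θ)⁻¹) hj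
    have hw0 : w (D j) ≠ 0 := hwθ j hj
    have hπ0 : π (D j) ≠ 0 := fun h0 => hw0 (hac h0)
    have hU0 : U j ≠ 0 := fun h0 => by simpa [h0, hLθ.ne'] using hUθ j hj
    have hpt0 : π (D j) ^ t ≠ 0 := by
      simp [ENNReal.rpow_eq_zero_iff, hπ0, measure_ne_top]
    have hUt : U j ≠ ∞ := fun h0 => by
      refine hU (top_le_iff.1 ?_)
      calc ∞ = π (D j) ^ t * U j := by rw [h0, ENNReal.mul_top hpt0]
        _ ≤ _ := ENNReal.le_tsum j
    have lpos : (0 : ℝ) < L θ := hLθ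
    have fpos : 0 < f θ := by positivity
    have wpos : 0 < (w (D j)).toReal := ENNReal.toReal_pos hw0 (measure_ne_top _ _)
    have ppos : 0 < (π (D j)).toReal := ENNReal.toReal_pos hπ0 (measure_ne_top _ _)
    have upos : 0 < (U j).toReal := ENNReal.toReal_pos hU0 hUt
    have wle : (w (D j)).toReal ≤ 1 :=
      ENNReal.toReal_le_of_le_ofReal zero_le_one (by simpa using prob_le_one)
    have luj : (L θ : ℝ) ≤ (U j).toReal := by
      have := ENNReal.toReal_mono hUt (hUθ j hj)
      simpa using this
    have vF1 : (F1 θ).toReal = √(L θ) * Real.exp (e θ) * (f θ)⁻¹ := by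
      simp only [hF1, hF, ENNReal.toReal_mul, ENNReal.toReal_inv]
      rw [ENNReal.toReal_ofReal (by positivity), ENNReal.toReal_ofReal fpos.le]
    have vG1 : (G1 θ).toReal = (π (D j)).toReal ^ t * (U j).toReal / (w (D j)).toReal := by
      rw [e1, ENNReal.toReal_div, ENNReal.toReal_mul, ENNReal.toReal_rpow]
    have vG2 : (G2 θ).toReal = (w (D j)).toReal / (π (D j)).toReal * (f θ)⁻¹ := by
      rw [e2, ENNReal.toReal_mul, ENNReal.toReal_div, ENNReal.toReal_inv,
        ENNReal.toReal_ofReal fpos.le]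
    have lF1 := Real.log_le_sub_one_of_pos (x := (F1 θ).toReal) (by rw [vF1]; positivity)
    have lG2 := Real.log_le_sub_one_of_pos (x := (G2 θ).toReal) (by rw [vG2]; positivity)
    have lG1 := Real.log_le_sub_one_of_pos (x := (G1 θ).toReal / Real.exp k)
      (by rw [vG1]; positivity)
    have ptp : 0 < (π (D j)).toReal ^ t := by positivity
    have sF1 : Real.log (F1 θ).toReal = Real.log (L θ) / 2 + e θ - Real.log (f θ) := by
      rw [vF1, Real.log_mul (by positivity) (by positivity),
        Real.log_mul (by positivity) (by positivity), Real.log_inv, Real.log_exp,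
        Real.log_sqrt lpos.le]
      ring
    have sG1 : Real.log ((G1 θ).toReal / Real.exp k) = t * Real.log (π (D j)).toReal
        + Real.log (U j).toReal - Real.log (w (D j)).toReal - k := by
      rw [vG1, Real.log_div (by positivity) (by positivity),
        Real.log_div (by positivity) (by positivity), Real.log_mul ptp.ne' upos.ne',
        Real.log_rpow ppos, Real.log_exp]
    have sG2 : Real.log (G2 θ).toReal = Real.log (w (D j)).toReal
        - Real.log (π (D j)).toReal - Real.log (f θ) := by
      rw [vG2, Real.log_mul (by positivity) (by positivity),
        Real.log_div (by positivity) (by positivity), Real.log_inv]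
      ring
    have sf : Real.log (f θ) = b θ + Real.log (L θ) - Real.log Z := by
      simp only [hf]
      rw [Real.log_div (by positivity) hZ.ne', Real.log_mul (by positivity) lpos.ne', Real.log_exp]
    have i1 : Real.log V ≤ Real.log Z := Real.log_le_log hV hVZ
    have i2 : Real.log (L θ) ≤ Real.log (U j).toReal := Real.log_le_log lpos luj
    -- In log G1 + t log G2 the prior mass of the cell cancels, and its w-mass survives with
    -- coefficient −(1 − t); this is where t ≤ 1 enters.
    have i3 : (1 - t) * Real.log (w (D j)).toReal ≤ 0 :=
      mul_nonpos_of_nonneg_of_nonpos (by linarith) (Real.log_nonpos wpos.le wle)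
    have i4 : Real.log (f θ) - Real.log (L θ) ≤ h - Real.log V := by linarith [hbh θ]
    have i5 : Real.log (L θ) - t * Real.log (f θ) ≤
        ((G1 θ).toReal / Real.exp k - 1 + k) + t * ((G2 θ).toReal - 1) := by
      have := mul_le_mul_of_nonneg_left lG2 ht0
      rw [sG2] at this
      rw [sG1] at lG1
      linarith
    have j4 := mul_le_mul_of_nonneg_left i4 (by linarith : 0 ≤ η)
    have j5 := mul_le_mul_of_nonneg_left i5 (by linarith : 0 ≤ η - 1 / 2)
    rw [sF1] at lF1
    have : (η - 1 / 2) * (Real.log (L θ) - t * Real.log (f θ))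
        = (η - 1 / 2) * Real.log (L θ) - (η - 1) * Real.log (f θ) := by rw [← hηt]; ring
    rw [this] at j5
    linarith
  have nF1 := integrable_toReal_of_lintegral_ne_top hF1m.aemeasurable
    (ne_top_of_le_ne_top hM iF1)
  have nG1 := integrable_toReal_of_lintegral_ne_top hG1m.aemeasurable
    (ne_top_of_le_ne_top hU iG1)
  have nG2 := integrable_toReal_of_lintegral_ne_top hG2m.aemeasurable
    (ne_top_of_le_ne_top ENNReal.one_ne_top iG2)
  have rF1 : ∫ θ, (F1 θ).toReal ∂w ≤ M.toReal := by
    rw [integral_toReal hF1m.aemeasurable tF1]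
    exact ENNReal.toReal_mono hM iF1
  have rG1 : ∫ θ, (G1 θ).toReal ∂w ≤ US.toReal := by
    rw [integral_toReal hG1m.aemeasurable tG1]
    exact ENNReal.toReal_mono hU iG1
  have rG2 : ∫ θ, (G2 θ).toReal ∂w ≤ 1 := by
    rw [integral_toReal hG2m.aemeasurable tG2]
    exact ENNReal.toReal_mono ENNReal.one_ne_top iG2
  have n1 : Integrable (fun θ => (F1 θ).toReal - 1) w := nF1.sub (integrable_const _)
  have n2 : Integrable (fun θ => (F1 θ).toReal - 1 + η * (h - Real.log V)) w :=
    n1.add (integrable_const _)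
  have n3 : Integrable (fun θ => (G1 θ).toReal / Real.exp k - 1 + k) w :=
    ((nG1.div_const _).sub (integrable_const _)).add (integrable_const _)
  have n4 : Integrable (fun θ => t * ((G2 θ).toReal - 1)) w :=
    (nG2.sub (integrable_const _)).const_mul _
  have n5 : Integrable (fun θ => (G1 θ).toReal / Real.exp k - 1 + k + t * ((G2 θ).toReal - 1)) w :=
    n3.add n4
  have n6 : Integrable (fun θ => (G1 θ).toReal / Real.exp k - 1) w :=
    (nG1.div_const _).sub (integrable_const _)
  refine (integral_mono_ae hei (n2.add (n5.const_mul (η - 1 / 2))) key).trans ?_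
  have calc1 : ∫ θ, ((F1 θ).toReal - 1 + η * (h - Real.log V)
      + (η - 1 / 2) * (((G1 θ).toReal / Real.exp k - 1 + k) + t * ((G2 θ).toReal - 1))) ∂w
      = ∫ θ, (F1 θ).toReal ∂w - 1 + η * (h - Real.log V)
      + (η - 1 / 2) * (((∫ θ, (G1 θ).toReal ∂w) / Real.exp k - 1 + k)
        + t * (∫ θ, (G2 θ).toReal ∂w - 1)) := by
    rw [integral_add n2 (n5.const_mul _), integral_add n1 (integrable_const _),
      integral_sub nF1 (integrable_const _), integral_const_mul (η - 1 / 2), integral_add n3 n4,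
      integral_add n6 (integrable_const _),
      integral_sub (nG1.div_const _) (integrable_const _), integral_div, integral_const_mul t,
      integral_sub nG2 (integrable_const _)]
    simp
  refine (le_of_eq calc1).trans ?_
  have : (∫ θ, (G1 θ).toReal ∂w) / Real.exp k ≤ US.toReal / Real.exp k := by gcongr
  have h2 : t * (∫ θ, (G2 θ).toReal ∂w - 1) ≤ 0 :=
    mul_nonpos_of_nonneg_of_nonpos ht0 (by linarith)
  have h3 := mul_le_mul_of_nonneg_left
    (show (∫ θ, (G1 θ).toReal ∂w) / Real.exp k - 1 + k + t * (∫ θ, (G2 θ).toReal ∂w - 1)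
      ≤ US.toReal / Real.exp k - 1 + k by linarith) (by linarith : 0 ≤ η - 1 / 2)
  linarith

/-- If the untilted posterior mass of `B` exceeds `1 / (1 + e^h)`, the tilted mass is at least a
half; in every case the tilted mass bounds the given right-hand side from below. -/
theorem half_posterior_indicator_le (π : Measure Γ) [IsProbabilityMeasure π]
    {L : Γ → ℝ≥0} (hL : Measurable L) {B : Set Γ} (hB : MeasurableSet B)
    {h c : ℝ} (hh : 0 ≤ h) (hc : 0 ≤ c)
    (hV0 : ∫⁻ θ, (L θ : ℝ≥0∞) ∂π ≠ 0) (hVt : ∫⁻ θ, (L θ : ℝ≥0∞) ∂π ≠ ∞)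
    {D : ℕ → Set Γ} (hDm : ∀ j, MeasurableSet (D j)) (hD : Pairwise (Function.onFun Disjoint D))
    (hDU : ⋃ j, D j = Set.univ) {U : ℕ → ℝ≥0∞}
    (hLU : ∀ j, ∀ᵐ θ ∂π.restrict (D j), (L θ : ℝ≥0∞) ≤ U j) {η t : ℝ} (hη : 1 ≤ η)
    (ht0 : 0 ≤ t) (ht1 : t ≤ 1) (hηt : (η - 1 / 2) * t = η - 1)
    (hU : ∑' j, π (D j) ^ t * U j ≠ ∞)
    (hM : ∫⁻ θ, ENNReal.ofReal (√(L θ) * Real.exp (B.indicator (fun _ => c) θ)) ∂π ≠ ∞) (k : ℝ)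
    {g : ℝ} (hg : g = 0 ∨ g = 1 / 2 ∧ ENNReal.ofReal (1 / (1 + Real.exp h)) <
      (∫⁻ θ in B, (L θ : ℝ≥0∞) ∂π) / ∫⁻ θ, (L θ : ℝ≥0∞) ∂π) :
    c * g ≤
      ((∫⁻ θ, ENNReal.ofReal (√(L θ) * Real.exp (B.indicator (fun _ => c) θ)) ∂π).toReal - 1)
        + η * (h - Real.log (∫⁻ θ, (L θ : ℝ≥0∞) ∂π).toReal)
        + (η - 1 / 2) * ((∑' j, π (D j) ^ t * U j).toReal / Real.exp k - 1 + k) := by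
  set V := (∫⁻ θ, (L θ : ℝ≥0∞) ∂π).toReal with hV
  have hLm : Measurable fun θ => (L θ : ℝ≥0∞) := hL.coe_nnreal_ennreal
  set v1 := ∫⁻ θ in B, (L θ : ℝ≥0∞) ∂π with hv1
  set v2 := ∫⁻ θ in Bᶜ, (L θ : ℝ≥0∞) ∂π with hv2
  have hsum : v1 + v2 = ∫⁻ θ, (L θ : ℝ≥0∞) ∂π := lintegral_add_compl _ hB
  have h1t : v1 ≠ ∞ := ne_top_of_le_ne_top hVt (hsum ▸ le_self_add)
  have h2t : v2 ≠ ∞ := ne_top_of_le_ne_top hVt (hsum ▸ le_add_self)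
  have hVs : V = v1.toReal + v2.toReal := by rw [hV, ← hsum, ENNReal.toReal_add h1t h2t]
  have hVpos : 0 < V := ENNReal.toReal_pos hV0 hVt
  have p1 : 0 ≤ v1.toReal := ENNReal.toReal_nonneg
  have p2 : 0 ≤ v2.toReal := ENNReal.toReal_nonneg
  have eh : 1 ≤ Real.exp h := Real.one_le_exp hh
  set Z := Real.exp h * v1.toReal + v2.toReal with hZ
  have hVZ : V ≤ Z := by rw [hVs, hZ]; nlinarith
  have hZpos : 0 < Z := hVpos.trans_le hVZ
  set b : Γ → ℝ := B.indicator fun _ => h with hbdef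
  have hb : Measurable b := measurable_const.indicator hB
  set F : Γ → ℝ≥0∞ := fun θ => ENNReal.ofReal (Real.exp (b θ) * L θ / Z) with hF
  have onB : ∫⁻ θ in B, F θ ∂π = ENNReal.ofReal (Real.exp h / Z) * v1 := by
    rw [hv1, ← lintegral_const_mul _ hLm]
    refine setLIntegral_congr_fun hB fun θ hθ => ?_
    simp only [hF, hbdef, Set.indicator_of_mem hθ]
    rw [mul_div_right_comm, ENNReal.ofReal_mul (by positivity), ENNReal.ofReal_coe_nnreal]
  have onBc : ∫⁻ θ in Bᶜ, F θ ∂π = ENNReal.ofReal (1 / Z) * v2 := by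
    rw [hv2, ← lintegral_const_mul _ hLm]
    refine setLIntegral_congr_fun hB.compl fun θ hθ => ?_
    simp only [hF, hbdef, Set.indicator_of_notMem hθ, Real.exp_zero]
    rw [mul_div_right_comm, ENNReal.ofReal_mul (by positivity), ENNReal.ofReal_coe_nnreal]
  have hwB : (π.withDensity F B).toReal = Real.exp h * v1.toReal / Z := by
    rw [withDensity_apply _ hB, onB, ENNReal.toReal_mul, ENNReal.toReal_ofReal (by positivity)]
    ring
  have hw : IsProbabilityMeasure (π.withDensity F) := by
    refine ⟨?_⟩
    rw [withDensity_apply _ MeasurableSet.univ, Measure.restrict_univ, ← lintegral_add_compl _ hB,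
      onB, onBc, ← ENNReal.ofReal_toReal h1t, ← ENNReal.ofReal_toReal h2t,
      ← ENNReal.ofReal_mul (by positivity), ← ENNReal.ofReal_mul (by positivity),
      ← ENNReal.ofReal_add (by positivity) (by positivity), ← ENNReal.ofReal_one]
    congr 1
    field_simp
    rw [hZ]
  have hbh : ∀ θ, b θ ≤ h := fun θ => by
    by_cases hθ : θ ∈ B <;> simp [hbdef, hθ, hh]
  have main := tilted_posterior_integral_le π hL hb
    (measurable_const.indicator hB : Measurable (B.indicator fun _ => c)) hbh hVpos hVZ
    ((integrable_const c).indicator hB) hDm hD hDU hLU hη ht0 ht1 hηt hU hM k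
  rw [integral_indicator hB, setIntegral_const, smul_eq_mul, measureReal_def] at main
  refine le_trans ?_ main
  change c * g ≤ (π.withDensity F B).toReal * c
  rw [mul_comm]
  refine mul_le_mul_of_nonneg_right ?_ hc
  -- The case g = 0 records that the right-hand side is nonnegative off the bad event, so that a
  -- single inequality can be integrated over all samples.
  rcases hg with rfl | ⟨rfl, hg⟩
  · exact ENNReal.toReal_nonneg
  · rw [← hsum] at hg
    have hfin : v1 / (v1 + v2) ≠ ∞ := ENNReal.div_ne_top h1t (hsum ▸ hV0)
    have := (ENNReal.toReal_lt_toReal ENNReal.ofReal_ne_top hfin).2 hg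
    rw [ENNReal.toReal_ofReal (by positivity), ENNReal.toReal_div, ENNReal.toReal_add h1t h2t,
      ← hVs, div_lt_div_iff₀ (by positivity) hVpos] at this
    rw [hwB, div_le_div_iff₀ (by norm_num) hZpos, hZ]
    rw [hVs] at this
    linarith

end Tilting

/-! ### Lower bounds for the evidence -/

section Evidence

variable {Γ 𝒳 : Type*} [MeasurableSpace Γ] [MeasurableSpace 𝒳]

theorem lintegral_pi_prod (Q : Measure 𝒳) [IsProbabilityMeasure Q] (n : ℕ) {g : 𝒳 → ℝ≥0∞}
    (hg : Measurable g) :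
    ∫⁻ X : Fin n → 𝒳, ∏ i, g (X i) ∂(Measure.pi fun _ => Q) = (∫⁻ x, g x ∂Q) ^ n := by
  rw [ProbabilityTheory.lintegral_prod_eq_prod_lintegral_of_indepFun Finset.univ
    (fun i (X : Fin n → 𝒳) => g (X i))
    (ProbabilityTheory.iIndepFun_pi (X := fun _ => g) fun _ => hg.aemeasurable)
    (fun i => hg.comp (measurable_pi_apply i))]
  have : ∀ i : Fin n, ∫⁻ X : Fin n → 𝒳, g (X i) ∂(Measure.pi fun _ => Q) = ∫⁻ x, g x ∂Q :=
    fun i => (measurePreserving_eval (fun _ => Q) i).lintegral_comp hg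
  simp [this]

/-- The positive part of log r is at most r. A likelihood ratio has integral at most 1, so an upper
bound on the divergence also bounds the L¹ norm of the log ratio. -/
theorem abs_log_le (r : ℝ≥0) : |Real.log r| ≤ -Real.log r + 2 * r := by
  rcases abs_cases (Real.log r) with ⟨h, _⟩ | ⟨h, _⟩ <;> rw [h]
  · linarith [Real.log_le_self r.coe_nonneg]
  · linarith [r.coe_nonneg]

/-- Jensen's inequality for the logarithm. -/
theorem integral_log_le_log_integral (ν : Measure Γ) [IsProbabilityMeasure ν] {f : Γ → ℝ}
    (hf : Integrable f ν) (hpos : ∀ᵐ θ ∂ν, 0 < f θ)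
    (hlog : Integrable (fun θ => Real.log (f θ)) ν) :
    ∫ θ, Real.log (f θ) ∂ν ≤ Real.log (∫ θ, f θ ∂ν) ∧ 0 < ∫ θ, f θ ∂ν := by
  have hA : 0 < ∫ θ, f θ ∂ν := by
    rw [integral_pos_iff_support_of_nonneg_ae (hpos.mono fun _ h => h.le) hf]
    have : ν (Function.support f) = 1 :=
      (prob_compl_eq_zero_iff₀ (by
        exact hf.1.aemeasurable.nullMeasurable (measurableSet_singleton (0:ℝ)).compl)).1
        (by
          refine measure_mono_null (fun θ hθ => ?_) (ae_iff.1 hpos)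
          simp only [Set.mem_compl_iff, Function.mem_support, not_not] at hθ
          simp [hθ])
    simp [this]
  refine ⟨?_, hA⟩
  set A := ∫ θ, f θ ∂ν with hAdef
  have i1 : Integrable (fun θ => f θ / A - 1) ν := (hf.div_const _).sub (integrable_const _)
  -- The tangent line of the logarithm at the mean A.
  have h1 : ∀ᵐ θ ∂ν, Real.log (f θ) ≤ f θ / A - 1 + Real.log A := by
    filter_upwards [hpos] with θ hθ
    have := Real.log_le_sub_one_of_pos (div_pos hθ hA)
    rw [Real.log_div hθ.ne' hA.ne'] at this
    linarith
  refine (integral_mono_ae hlog (i1.add (integrable_const _)) h1).trans ?_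
  have : ∫ θ, (f θ / A - 1 + Real.log A) ∂ν = A / A - 1 + Real.log A := by
    rw [integral_add i1 (integrable_const _), integral_sub (hf.div_const _) (integrable_const _),
      integral_div]
    simp
    rfl
  refine (le_of_eq this).trans ?_
  rw [div_self hA.ne']
  linarith

theorem integrable_ratio (Q : Measure 𝒳) {R : Γ → 𝒳 → ℝ≥0}
    (hR : Measurable (Function.uncurry R)) (hR1 : ∀ θ, ∫⁻ x, (R θ x : ℝ≥0∞) ∂Q ≤ 1) (θ : Γ) : Integrable (fun x => (R θ x : ℝ)) Q ∧
    ∫ x, (R θ x : ℝ) ∂Q ≤ 1 := by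
  have hm : Measurable fun x => (R θ x : ℝ≥0∞) := hR.of_uncurry_left.coe_nnreal_ennreal
  have := integrable_toReal_of_lintegral_ne_top hm.aemeasurable
    (ne_top_of_le_ne_top ENNReal.one_ne_top (hR1 θ))
  refine ⟨by simpa using this, ?_⟩
  have h2 := integral_toReal hm.aemeasurable (Filter.Eventually.of_forall fun x =>
    (ENNReal.coe_lt_top : (R θ x : ℝ≥0∞) < ∞)) (μ := Q)
  simp only [ENNReal.coe_toReal] at h2
  rw [h2]
  exact ENNReal.toReal_le_of_le_ofReal zero_le_one (by simpa using hR1 θ)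

theorem integral_comp_eval (Q : Measure 𝒳) [IsProbabilityMeasure Q] {n : ℕ} (i : Fin n)
    {f : 𝒳 → ℝ} (hf : AEStronglyMeasurable f Q) :
    ∫ X : Fin n → 𝒳, f (X i) ∂(Measure.pi fun _ => Q) = ∫ x, f x ∂Q := by
  have h := (measurePreserving_eval (fun _ : Fin n => Q) i).map_eq
  have hf' : AEStronglyMeasurable f ((Measure.pi fun _ : Fin n => Q).map (Function.eval i)) := by
    rwa [h]
  calc _ = ∫ x, f x ∂((Measure.pi fun _ : Fin n => Q).map (Function.eval i)) :=
        (integral_map (measurable_pi_apply i).aemeasurable hf').symm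
    _ = _ := by rw [h]

/-- Jensen bound for the evidence in terms of the prior conditioned on `A`. -/
theorem neg_log_lintegral_le (π : Measure Γ) [IsProbabilityMeasure π] {L : Γ → ℝ≥0}
    (hL : Measurable L) {A : Set Γ} {d : ℝ} (hd : ENNReal.ofReal (Real.exp (-d)) ≤ π A)
    (hpos : ∀ᵐ θ ∂(ProbabilityTheory.cond π A), 0 < L θ)
    (hlog : Integrable (fun θ => Real.log (L θ)) (ProbabilityTheory.cond π A)) :
    ∫⁻ θ, (L θ : ℝ≥0∞) ∂π ≠ 0 ∧ (∫⁻ θ, (L θ : ℝ≥0∞) ∂π ≠ ∞ →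
      -Real.log (∫⁻ θ, (L θ : ℝ≥0∞) ∂π).toReal ≤
        d - ∫ θ, Real.log (L θ) ∂(ProbabilityTheory.cond π A)) := by
  have hπA : π A ≠ 0 := fun h0 => by
    rw [h0, nonpos_iff_eq_zero, ENNReal.ofReal_eq_zero] at hd
    exact absurd (Real.exp_pos (-d)) (not_lt.2 hd)
  have hπr : 0 < (π A).toReal := ENNReal.toReal_pos hπA (measure_ne_top _ _)
  set ν := ProbabilityTheory.cond π A with hν
  have hνp : IsProbabilityMeasure ν := ProbabilityTheory.cond_isProbabilityMeasure hπA
  set V := ∫⁻ θ, (L θ : ℝ≥0∞) ∂π with hV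
  have hLm : Measurable fun θ => (L θ : ℝ≥0∞) := hL.coe_nnreal_ennreal
  have hνle : ∫⁻ θ, (L θ : ℝ≥0∞) ∂ν ≤ (π A)⁻¹ * V := by
    rw [hν, ProbabilityTheory.cond, lintegral_smul_measure, smul_eq_mul]
    gcongr
    exact setLIntegral_le_lintegral _ _
  have hV0 : V ≠ 0 := by
    intro h0
    have h1 := (lintegral_eq_zero_iff hLm).1 h0
    have h2 : ∀ᵐ θ ∂ν, (L θ : ℝ≥0∞) = 0 :=
      ProbabilityTheory.cond_absolutelyContinuous.ae_le h1
    obtain ⟨θ, h3, h4⟩ := (hpos.and h2).exists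
    exact h3.ne' (by exact_mod_cast h4)
  refine ⟨hV0, fun hVt => ?_⟩
  have hfin : (π A)⁻¹ * V ≠ ∞ := ENNReal.mul_ne_top (ENNReal.inv_ne_top.2 hπA) hVt
  have hint : Integrable (fun θ => (L θ : ℝ)) ν := by
    simpa using integrable_toReal_of_lintegral_ne_top hLm.aemeasurable
      (ne_top_of_le_ne_top hfin hνle)
  have hval : ∫ θ, (L θ : ℝ) ∂ν = (∫⁻ θ, (L θ : ℝ≥0∞) ∂ν).toReal := by
    rw [← integral_toReal hLm.aemeasurable
      (Filter.Eventually.of_forall fun _ => ENNReal.coe_lt_top)]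
    simp
  obtain ⟨j1, j2⟩ := integral_log_le_log_integral ν hint
    (hpos.mono fun θ h => by exact_mod_cast h) hlog
  have j3 : ∫ θ, (L θ : ℝ) ∂ν ≤ V.toReal / (π A).toReal := by
    rw [hval]
    have := ENNReal.toReal_mono hfin hνle
    rw [ENNReal.toReal_mul, ENNReal.toReal_inv] at this
    rwa [div_eq_inv_mul]
  have hVr : 0 < V.toReal := ENNReal.toReal_pos hV0 hVt
  have j4 := Real.log_le_log j2 j3
  rw [Real.log_div hVr.ne' hπr.ne'] at j4
  -- Restricting the evidence integral to A and normalising costs −log π(A), which is at most d.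
  have j5 : -d ≤ Real.log (π A).toReal := by
    rw [Real.le_log_iff_exp_le hπr]
    exact (ENNReal.ofReal_le_iff_le_toReal (measure_ne_top _ _)).1 hd
  linarith

theorem integrable_sum_eval (ν : Measure Γ) [IsProbabilityMeasure ν] (Q : Measure 𝒳)
    [IsProbabilityMeasure Q] (n : ℕ) {f : Γ → 𝒳 → ℝ}
    (hf : Integrable (Function.uncurry f) (ν.prod Q)) :
    Integrable (fun z : Γ × (Fin n → 𝒳) => ∑ i, f z.1 (z.2 i))
      (ν.prod (Measure.pi fun _ => Q)) :=
  integrable_finsetSum _ fun i _ =>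
    ((MeasurePreserving.id ν).prod
      (measurePreserving_eval (fun _ : Fin n => Q) i)).integrable_comp_of_integrable hf

theorem integral_sum_eval (Q : Measure 𝒳) [IsProbabilityMeasure Q] (n : ℕ) {f : 𝒳 → ℝ}
    (hf : Integrable f Q) :
    ∫ X : Fin n → 𝒳, ∑ i, f (X i) ∂(Measure.pi fun _ => Q) = n * ∫ x, f x ∂Q := by
  have hi : ∀ i : Fin n, Integrable (fun X : Fin n → 𝒳 => f (X i)) (Measure.pi fun _ => Q) :=
    fun i => (measurePreserving_eval (fun _ : Fin n => Q) i).integrable_comp_of_integrable hf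
  rw [integral_finsetSum _ fun i _ => hi i]
  simp [integral_comp_eval Q _ hf.1]

/-- Evidence bound: minus the logarithm of the evidence is bounded by an integrable function
of expectation at most `(n + 1) d`. -/
theorem exists_neg_log_evidence_le (Q : Measure 𝒳) [IsProbabilityMeasure Q] {R : Γ → 𝒳 → ℝ≥0}
    (hR : Measurable (Function.uncurry R)) (hR1 : ∀ θ, ∫⁻ x, (R θ x : ℝ≥0∞) ∂Q ≤ 1) (π : Measure Γ) [IsProbabilityMeasure π] (n : ℕ)
    {A : Set Γ} (hA : MeasurableSet A) {d : ℝ} (hd : ENNReal.ofReal (Real.exp (-d)) ≤ π A)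
    (hApos : ∀ θ ∈ A, ∀ᵐ x ∂Q, 0 < R θ x)
    (hAint : ∀ θ ∈ A, Integrable (fun x => Real.log (R θ x)) Q)
    (hAd : ∀ θ ∈ A, ∫ x, -Real.log (R θ x) ∂Q ≤ d) :
    ∃ W : (Fin n → 𝒳) → ℝ, Integrable W (Measure.pi fun _ => Q) ∧
      ∫ X, W X ∂(Measure.pi fun _ => Q) ≤ (n + 1) * d ∧
      ∀ᵐ X ∂(Measure.pi fun _ => Q), ∫⁻ θ, (∏ i, R θ (X i) : ℝ≥0) ∂π ≠ 0 ∧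
        (∫⁻ θ, (∏ i, R θ (X i) : ℝ≥0) ∂π ≠ ∞ →
          -Real.log (∫⁻ θ, (∏ i, R θ (X i) : ℝ≥0) ∂π).toReal ≤ W X) := by
  have hπA : π A ≠ 0 := fun h0 => by
    rw [h0, nonpos_iff_eq_zero, ENNReal.ofReal_eq_zero] at hd
    exact absurd (Real.exp_pos (-d)) (not_lt.2 hd)
  set ν := ProbabilityTheory.cond π A with hν
  have hνp : IsProbabilityMeasure ν := ProbabilityTheory.cond_isProbabilityMeasure hπA
  have hνA : ∀ᵐ θ ∂ν, θ ∈ A := ProbabilityTheory.ae_cond_mem hA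
  set P := Measure.pi fun _ : Fin n => Q with hP
  set f : Γ → 𝒳 → ℝ := fun θ x => Real.log (R θ x) with hf
  have hfm : Measurable (Function.uncurry f) := Real.measurable_log.comp hR.coe_nnreal_real
  have hfi : Integrable (Function.uncurry f) (ν.prod Q) := by
    rw [integrable_prod_iff hfm.aestronglyMeasurable]
    refine ⟨hνA.mono fun θ hθ => hAint θ hθ, ?_⟩
    refine Integrable.of_bound
      (hfm.norm.stronglyMeasurable.integral_prod_right.aestronglyMeasurable) (d + 2) ?_
    filter_upwards [hνA] with θ hθ
    rw [Real.norm_of_nonneg (integral_nonneg fun x => norm_nonneg _)]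
    obtain ⟨r1, r2⟩ := integrable_ratio Q hR hR1 θ
    calc ∫ x, ‖Function.uncurry f (θ, x)‖ ∂Q ≤ ∫ x, (-Real.log (R θ x) + 2 * R θ x) ∂Q :=
          integral_mono (hAint θ hθ).norm ((hAint θ hθ).neg.add (r1.const_mul 2))
            fun x => abs_log_le _
      _ = ∫ x, -Real.log (R θ x) ∂Q + 2 * ∫ x, (R θ x : ℝ) ∂Q := by
          have hneg : Integrable (fun x => -Real.log (R θ x)) Q := (hAint θ hθ).neg
          rw [integral_add hneg (r1.const_mul 2), integral_const_mul]
      _ ≤ d + 2 := by linarith [hAd θ hθ]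
  have hgi : Integrable (fun z : Γ × (Fin n → 𝒳) => ∑ i, f z.1 (z.2 i)) (ν.prod P) :=
    integrable_sum_eval ν Q n hfi
  have hLm : Measurable (fun z : Γ × (Fin n → 𝒳) => ∏ i, R z.1 (z.2 i)) :=
    Finset.measurable_prod _ fun i _ => hR.comp
      (measurable_fst.prodMk ((measurable_pi_apply i).comp measurable_snd))
  have hposθ : ∀ᵐ θ ∂ν, ∀ᵐ X ∂P, 0 < ∏ i, R θ (X i) := by
    filter_upwards [hνA] with θ hθ
    have : ∀ᵐ X ∂P, ∀ i, 0 < R θ (X i) := ae_all_iff.2 fun i =>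
      (measurePreserving_eval (fun _ : Fin n => Q) i).quasiMeasurePreserving.ae (hApos θ hθ)
    filter_upwards [this] with X hX
    exact Finset.prod_pos fun i _ => hX i
  have hms : MeasurableSet {z : Γ × (Fin n → 𝒳) | 0 < ∏ i, R z.1 (z.2 i)} :=
    measurableSet_lt (measurable_const (a := (0 : ℝ≥0))) hLm
  have hposX : ∀ᵐ X ∂P, ∀ᵐ θ ∂ν, 0 < ∏ i, R θ (X i) :=
    (Measure.ae_ae_comm hms).1 hposθ
  -- The Jensen bound itself serves as W: one d pays for conditioning the prior, and each of the n
  -- observations adds at most d in expectation.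
  refine ⟨fun X => d - ∫ θ, ∑ i, f θ (X i) ∂ν, ?_, ?_, ?_⟩
  · exact (integrable_const _).sub hgi.integral_prod_right
  · rw [integral_sub (integrable_const _) hgi.integral_prod_right,
      integral_integral_swap (f := fun (X : Fin n → 𝒳) (θ : Γ) => ∑ i, f θ (X i)) hgi.swap]
    have h1 : ∫ θ, (-(n * d) : ℝ) ∂ν ≤ ∫ θ, ∫ X, ∑ i, f θ (X i) ∂P ∂ν := by
      refine integral_mono_ae (integrable_const _) hgi.integral_prod_left ?_
      filter_upwards [hνA] with θ hθ
      have h2 := hAd θ hθ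
      rw [integral_neg] at h2
      have h3 := mul_le_mul_of_nonneg_left h2 (Nat.cast_nonneg (α := ℝ) n)
      rw [integral_sum_eval Q n (hAint θ hθ)]
      linarith
    simp only [integral_const, probReal_univ, one_smul] at h1 ⊢
    linarith
  · filter_upwards [hposX, hgi.prod_left_ae] with X hX hgX
    have hLX : Measurable fun θ => ∏ i, R θ (X i) :=
      hLm.comp (measurable_id.prodMk measurable_const)
    have hlogs : (fun θ => Real.log ((∏ i, R θ (X i) : ℝ≥0) : ℝ)) =ᵐ[ν] fun θ => ∑ i, f θ (X i) := by
      filter_upwards [hX] with θ hθ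
      have : ∀ i ∈ Finset.univ, (R θ (X i) : ℝ) ≠ 0 := fun i hi => by
        have := Finset.prod_ne_zero_iff.1 hθ.ne' i hi
        exact_mod_cast this
      rw [NNReal.coe_prod, Real.log_prod this]
    obtain ⟨h0, h1⟩ := neg_log_lintegral_le π hLX hd hX ((integrable_congr hlogs).2 hgX)
    refine ⟨h0, fun hVt => (h1 hVt).trans (le_of_eq ?_)⟩
    rw [integral_congr_ae hlogs]

end Evidence

/-! ### Averaging over the sample -/

section Concentration

variable {Γ 𝒳 : Type*} [MeasurableSpace Γ] [MeasurableSpace 𝒳]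

theorem measurable_prod_ratio {R : Γ → 𝒳 → ℝ≥0} (hR : Measurable (Function.uncurry R)) (n : ℕ) :
    Measurable (fun z : Γ × (Fin n → 𝒳) => ∏ i, R z.1 (z.2 i)) :=
  Finset.measurable_prod _ fun i _ => hR.comp
    (measurable_fst.prodMk ((measurable_pi_apply i).comp measurable_snd))

/-- Needed to know that the evidence is almost surely finite. -/
theorem lintegral_evidence_le (Q : Measure 𝒳) [IsProbabilityMeasure Q] {R : Γ → 𝒳 → ℝ≥0}
    (hR : Measurable (Function.uncurry R)) (hR1 : ∀ θ, ∫⁻ x, (R θ x : ℝ≥0∞) ∂Q ≤ 1)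
    (π : Measure Γ) [IsProbabilityMeasure π] (n : ℕ) :
    ∫⁻ X, ∫⁻ θ, (∏ i, R θ (X i) : ℝ≥0) ∂π ∂(Measure.pi fun _ : Fin n => Q) ≤ 1 := by
  have hm : Measurable fun z : (Fin n → 𝒳) × Γ => ((∏ i, R z.2 (z.1 i) : ℝ≥0) : ℝ≥0∞) :=
    ((measurable_prod_ratio hR n).comp measurable_swap).coe_nnreal_ennreal
  rw [lintegral_lintegral_swap hm.aemeasurable]
  calc _ ≤ ∫⁻ _, 1 ∂π := by
        refine lintegral_mono fun θ => ?_
        simp only [ENNReal.ofNNReal_finsetProd]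
        rw [lintegral_pi_prod Q n (g := fun x => (R θ x : ℝ≥0∞))
          hR.of_uncurry_left.coe_nnreal_ennreal]
        exact pow_le_one₀ zero_le (hR1 θ)
    _ = 1 := by simp

/-- After exchanging the integrals, independence turns the inner one into the n-th power of the
affinity. On B it is at most e^{−nτ}, which cancels the exponential weight; off B the weight is 1.
-/
theorem lintegral_sqrt_ratio_le (Q : Measure 𝒳) [IsProbabilityMeasure Q] {R : Γ → 𝒳 → ℝ≥0}
    (hR : Measurable (Function.uncurry R)) (π : Measure Γ) [IsProbabilityMeasure π] (n : ℕ)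
    {B : Set Γ} (hB : MeasurableSet B) {τ : ℝ}
    (hR1 : ∀ θ, ∫⁻ x, ENNReal.ofReal √(R θ x) ∂Q ≤ 1)
    (hRB : ∀ θ ∈ B, ∫⁻ x, ENNReal.ofReal √(R θ x) ∂Q ≤ ENNReal.ofReal (Real.exp (-τ))) :
    ∫⁻ X, ∫⁻ θ, ENNReal.ofReal (√((∏ i, R θ (X i) : ℝ≥0) : ℝ)
      * Real.exp (B.indicator (fun _ => n * τ) θ)) ∂π ∂(Measure.pi fun _ : Fin n => Q) ≤ 1 := by
  have hm : Measurable fun z : (Fin n → 𝒳) × Γ => ENNReal.ofReal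
      (√((∏ i, R z.2 (z.1 i) : ℝ≥0) : ℝ) * Real.exp (B.indicator (fun _ => n * τ) z.2)) := by
    have h1 : Measurable fun z : (Fin n → 𝒳) × Γ => √((∏ i, R z.2 (z.1 i) : ℝ≥0) : ℝ) :=
      ((measurable_prod_ratio hR n).comp measurable_swap).coe_nnreal_real.sqrt
    have h2 : Measurable fun z : (Fin n → 𝒳) × Γ => B.indicator (fun _ => (n * τ : ℝ)) z.2 :=
      (measurable_const.indicator hB).comp measurable_snd
    exact (h1.mul h2.exp).ennreal_ofReal
  rw [lintegral_lintegral_swap hm.aemeasurable]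
  have hθ : ∀ θ, ∫⁻ X : Fin n → 𝒳, ENNReal.ofReal (√((∏ i, R θ (X i) : ℝ≥0) : ℝ)
      * Real.exp (B.indicator (fun _ => n * τ) θ)) ∂(Measure.pi fun _ : Fin n => Q)
      = (∫⁻ x, ENNReal.ofReal √(R θ x) ∂Q) ^ n
        * ENNReal.ofReal (Real.exp (B.indicator (fun _ => n * τ) θ)) := by
    intro θ
    have hg : Measurable fun x => ENNReal.ofReal √(R θ x : ℝ) :=
      (hR.of_uncurry_left (x := θ)).coe_nnreal_real.sqrt.ennreal_ofReal
    have hgp : Measurable fun X : Fin n → 𝒳 => ∏ i, ENNReal.ofReal √(R θ (X i) : ℝ) :=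
      Finset.measurable_prod _ fun i _ => hg.comp (measurable_pi_apply i)
    rw [← lintegral_pi_prod Q n hg, ← lintegral_mul_const _ hgp]
    refine lintegral_congr fun X => ?_
    rw [ENNReal.ofReal_mul (Real.sqrt_nonneg _), NNReal.coe_prod,
      Real.sqrt_prod _ fun i _ => (R θ (X i)).coe_nonneg,
      ENNReal.ofReal_prod_of_nonneg fun i _ => Real.sqrt_nonneg _]
  calc _ ≤ ∫⁻ _, 1 ∂π := by
        refine lintegral_mono fun θ => ?_
        rw [hθ θ]
        by_cases h : θ ∈ B
        · rw [Set.indicator_of_mem h]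
          calc _ ≤ ENNReal.ofReal (Real.exp (-τ)) ^ n * ENNReal.ofReal (Real.exp (n * τ)) := by
                gcongr; exact hRB θ h
            _ = 1 := by
                rw [← ENNReal.ofReal_pow (Real.exp_pos _).le, ← ENNReal.ofReal_mul (by positivity),
                  ← Real.exp_nat_mul, ← Real.exp_add]
                simp
        · rw [Set.indicator_of_notMem h]
          simpa using pow_le_one₀ zero_le (hR1 θ)
    _ = 1 := by simp

theorem lintegral_bracket_sum (Q : Measure 𝒳) [IsProbabilityMeasure Q] (n : ℕ) (c : ℕ → ℝ≥0∞)
    {U : ℕ → 𝒳 → ℝ≥0∞} (hU : ∀ j, Measurable (U j)) :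
    ∫⁻ X, ∑' j, c j * ∏ i, U j (X i) ∂(Measure.pi fun _ : Fin n => Q) =
      ∑' j, c j * (∫⁻ x, U j x ∂Q) ^ n := by
  have hm : ∀ j, Measurable fun X : Fin n → 𝒳 => ∏ i, U j (X i) := fun j =>
    Finset.measurable_prod _ fun i _ => (hU j).comp (measurable_pi_apply i)
  rw [lintegral_tsum fun j => ((hm j).const_mul _).aemeasurable]
  refine tsum_congr fun j => ?_
  rw [lintegral_const_mul _ (hm j), lintegral_pi_prod Q n (hU j)]

/-- The probability that the posterior mass of `B` is large, in terms of likelihood ratios `R`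
with respect to the true distribution `Q`. -/
theorem prob_posterior_gt_le (Q : Measure 𝒳) [IsProbabilityMeasure Q] {R : Γ → 𝒳 → ℝ≥0}
    (hR : Measurable (Function.uncurry R)) (hR1 : ∀ θ, ∫⁻ x, (R θ x : ℝ≥0∞) ∂Q ≤ 1)
    (π : Measure Γ) [IsProbabilityMeasure π] (n : ℕ)
    {A : Set Γ} (hA : MeasurableSet A) {d : ℝ} (hd : ENNReal.ofReal (Real.exp (-d)) ≤ π A)
    (hApos : ∀ θ ∈ A, ∀ᵐ x ∂Q, 0 < R θ x)
    (hAint : ∀ θ ∈ A, Integrable (fun x => Real.log (R θ x)) Q)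
    (hAd : ∀ θ ∈ A, ∫ x, -Real.log (R θ x) ∂Q ≤ d)
    {B : Set Γ} (hB : MeasurableSet B) {τ : ℝ} (hτ : 0 ≤ τ)
    (hS1 : ∀ θ, ∫⁻ x, ENNReal.ofReal √(R θ x) ∂Q ≤ 1)
    (hSB : ∀ θ ∈ B, ∫⁻ x, ENNReal.ofReal √(R θ x) ∂Q ≤ ENNReal.ofReal (Real.exp (-τ)))
    {D : ℕ → Set Γ} (hDm : ∀ j, MeasurableSet (D j)) (hD : Pairwise (Function.onFun Disjoint D))
    (hDU : ⋃ j, D j = Set.univ) {U : ℕ → 𝒳 → ℝ≥0∞} (hUm : ∀ j, Measurable (U j))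
    (hRU : ∀ j x, ∀ᵐ θ ∂π.restrict (D j), (R θ x : ℝ≥0∞) ≤ U j x)
    {η t u h : ℝ} (hη : 1 ≤ η) (ht0 : 0 ≤ t) (ht1 : t ≤ 1) (hηt : (η - 1 / 2) * t = η - 1)
    (hU : ∑' j, π (D j) ^ t * (∫⁻ x, U j x ∂Q) ^ n ≤ ENNReal.ofReal (Real.exp u)) (hh : 0 ≤ h) :
    MeasurableSet {X : Fin n → 𝒳 | ENNReal.ofReal (1 / (1 + Real.exp h)) <
      (∫⁻ θ in B, (∏ i, R θ (X i) : ℝ≥0) ∂π) / ∫⁻ θ, (∏ i, R θ (X i) : ℝ≥0) ∂π} ∧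
    n * τ / 2 * (Measure.pi fun _ : Fin n => Q).real {X | ENNReal.ofReal (1 / (1 + Real.exp h)) <
      (∫⁻ θ in B, (∏ i, R θ (X i) : ℝ≥0) ∂π) / ∫⁻ θ, (∏ i, R θ (X i) : ℝ≥0) ∂π} ≤
      η * h + η * ((n + 1) * d) + (η - 1 / 2) * u := by
  set P := Measure.pi fun _ : Fin n => Q with hP
  have hLm := measurable_prod_ratio hR n
  have hLm' : Measurable fun z : (Fin n → 𝒳) × Γ => ((∏ i, R z.2 (z.1 i) : ℝ≥0) : ℝ≥0∞) :=
    (hLm.comp measurable_swap).coe_nnreal_ennreal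
  have hVm : Measurable fun X : Fin n → 𝒳 => ∫⁻ θ, (∏ i, R θ (X i) : ℝ≥0) ∂π :=
    hLm'.lintegral_prod_right'
  have hNm : Measurable fun X : Fin n → 𝒳 => ∫⁻ θ in B, (∏ i, R θ (X i) : ℝ≥0) ∂π :=
    hLm'.lintegral_prod_right'
  set E := {X : Fin n → 𝒳 | ENNReal.ofReal (1 / (1 + Real.exp h)) <
      (∫⁻ θ in B, (∏ i, R θ (X i) : ℝ≥0) ∂π) / ∫⁻ θ, (∏ i, R θ (X i) : ℝ≥0) ∂π} with hE
  have hEm : MeasurableSet E := measurableSet_lt measurable_const (hNm.div hVm)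
  refine ⟨hEm, ?_⟩
  obtain ⟨W, hWi, hW, hWae⟩ := exists_neg_log_evidence_le Q hR hR1 π n hA hd hApos hAint hAd
  set Φ : (Fin n → 𝒳) → ℝ≥0∞ := fun X => ∫⁻ θ, ENNReal.ofReal (√((∏ i, R θ (X i) : ℝ≥0) : ℝ)
      * Real.exp (B.indicator (fun _ => n * τ) θ)) ∂π with hΦ
  set Ψ : (Fin n → 𝒳) → ℝ≥0∞ := fun X => ∑' j, π (D j) ^ t * ∏ i, U j (X i) with hΨ
  have hΦ1 : ∫⁻ X, Φ X ∂P ≤ 1 := lintegral_sqrt_ratio_le Q hR π n hB hS1 hSB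
  have hΨ1 : ∫⁻ X, Ψ X ∂P ≤ ENNReal.ofReal (Real.exp u) :=
    (lintegral_bracket_sum Q n _ hUm).trans_le hU
  have hΦm : Measurable Φ := by
    have h1 : Measurable fun z : (Fin n → 𝒳) × Γ => √((∏ i, R z.2 (z.1 i) : ℝ≥0) : ℝ) :=
      (hLm.comp measurable_swap).coe_nnreal_real.sqrt
    have h2 : Measurable fun z : (Fin n → 𝒳) × Γ => B.indicator (fun _ => (n * τ : ℝ)) z.2 :=
      (measurable_const.indicator hB).comp measurable_snd
    exact (h1.mul h2.exp).ennreal_ofReal.lintegral_prod_right'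
  have hΨm : Measurable Ψ := Measurable.tsum fun j => Measurable.const_mul
    (Finset.measurable_prod _ fun i _ => (hUm j).comp (measurable_pi_apply i)) _
  have tΦ := ae_lt_top hΦm (ne_top_of_le_ne_top ENNReal.one_ne_top hΦ1)
  have tΨ := ae_lt_top hΨm (ne_top_of_le_ne_top ENNReal.ofReal_ne_top hΨ1)
  have tV := ae_lt_top hVm
    (ne_top_of_le_ne_top ENNReal.one_ne_top (lintegral_evidence_le Q hR hR1 π n))
  have nΦ := integrable_toReal_of_lintegral_ne_top hΦm.aemeasurable
    (ne_top_of_le_ne_top ENNReal.one_ne_top hΦ1)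
  have nΨ := integrable_toReal_of_lintegral_ne_top hΨm.aemeasurable
    (ne_top_of_le_ne_top ENNReal.ofReal_ne_top hΨ1)
  have rΦ : ∫ X, (Φ X).toReal ∂P ≤ 1 := by
    rw [integral_toReal hΦm.aemeasurable tΦ]
    exact ENNReal.toReal_le_of_le_ofReal zero_le_one (by simpa using hΦ1)
  have rΨ : ∫ X, (Ψ X).toReal ∂P ≤ Real.exp u := by
    rw [integral_toReal hΨm.aemeasurable tΨ]
    exact ENNReal.toReal_le_of_le_ofReal (Real.exp_pos _).le hΨ1
  have key : ∀ᵐ X ∂P, n * τ * E.indicator (fun _ => 1 / 2) X ≤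
      ((Φ X).toReal - 1) + (η * h + η * W X)
        + (η - 1 / 2) * ((Ψ X).toReal / Real.exp u - 1 + u) := by
    filter_upwards [tΦ, tΨ, tV, hWae] with X h1 h2 h3 h4
    have hLU : ∀ j, ∀ᵐ θ ∂π.restrict (D j),
        ((∏ i, R θ (X i) : ℝ≥0) : ℝ≥0∞) ≤ ∏ i, U j (X i) := by
      intro j
      filter_upwards [ae_all_iff.2 fun i => hRU j (X i)] with θ hθ
      rw [ENNReal.ofNNReal_finsetProd]
      exact Finset.prod_le_prod' fun i _ => hθ i
    have hLX : Measurable fun θ => ∏ i, R θ (X i) :=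
      hLm.comp (measurable_id.prodMk measurable_const)
    -- The free parameter k is taken to be u, which does not depend on X: then Ψ/e^u has expectation
    -- at most 1 and cancels the −1 after integration.
    have h5 := half_posterior_indicator_le π hLX hB hh (c := n * τ) (by positivity) h4.1 h3.ne
      hDm hD hDU hLU hη ht0 ht1 hηt h2.ne h1.ne u (g := E.indicator (fun _ => 1 / 2) X) (by
        by_cases hX : X ∈ E
        · exact Or.inr ⟨Set.indicator_of_mem hX _, hX⟩
        · exact Or.inl (Set.indicator_of_notMem hX _))
    have h6 := mul_le_mul_of_nonneg_left (h4.2 h3.ne) (by linarith : 0 ≤ η)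
    change _ ≤ ((Φ X).toReal - 1) + _ + (η - 1 / 2) * ((Ψ X).toReal / Real.exp u - 1 + u) at h5
    linarith
  have n1 : Integrable (fun X => (Φ X).toReal - 1) P := nΦ.sub (integrable_const _)
  have n2 : Integrable (fun X => η * h + η * W X) P :=
    (integrable_const _).add (hWi.const_mul η)
  have n3 : Integrable (fun X => (Ψ X).toReal / Real.exp u - 1) P :=
    (nΨ.div_const _).sub (integrable_const _)
  have n4 : Integrable (fun X => (Ψ X).toReal / Real.exp u - 1 + u) P :=
    n3.add (integrable_const _)
  have n5 : Integrable (fun X => (Φ X).toReal - 1 + (η * h + η * W X)) P := n1.add n2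
  have hi : Integrable (fun X => n * τ * E.indicator (fun _ => (1 / 2 : ℝ)) X) P :=
    ((integrable_const _).indicator hEm).const_mul _
  have h1 := integral_mono_ae hi (n5.add (n4.const_mul (η - 1 / 2))) key
  have h2 : ∫ X, ((Φ X).toReal - 1 + (η * h + η * W X)
        + (η - 1 / 2) * ((Ψ X).toReal / Real.exp u - 1 + u)) ∂P
      = (∫ X, (Φ X).toReal ∂P - 1) + (η * h + η * ∫ X, W X ∂P)
        + (η - 1 / 2) * ((∫ X, (Ψ X).toReal ∂P) / Real.exp u - 1 + u) := by
    rw [integral_add n5 (n4.const_mul _), integral_add n1 n2,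
      integral_sub nΦ (integrable_const _), integral_add (integrable_const _) (hWi.const_mul η),
      integral_const_mul η W, integral_const_mul (η - 1 / 2), integral_add n3 (integrable_const _),
      integral_sub (nΨ.div_const _) (integrable_const _), integral_div]
    simp only [integral_const, probReal_univ, one_smul]
    rfl
  have h3 : ∫ X, n * τ * E.indicator (fun _ => (1 / 2 : ℝ)) X ∂P = n * τ / 2 * P.real E := by
    rw [integral_const_mul, integral_indicator hEm, setIntegral_const, smul_eq_mul]
    ring
  rw [h3] at h1
  have h4 := h1.trans_eq h2
  have h5 : (∫ X, (Ψ X).toReal ∂P) / Real.exp u ≤ 1 := (div_le_one (Real.exp_pos u)).2 rΨ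
  have h6 := mul_le_mul_of_nonneg_left
    (show (∫ X, (Ψ X).toReal ∂P) / Real.exp u - 1 + u ≤ u by linarith)
    (by linarith : 0 ≤ η - 1 / 2)
  have h7 := mul_le_mul_of_nonneg_left hW (by linarith : 0 ≤ η)
  linarith

end Concentration

/-! ### Hellinger affinity, Kullback-Leibler divergence and measurability -/

section Densities

variable {Γ 𝒳 : Type*} [MeasurableSpace 𝒳] {μ : Measure 𝒳}

theorem IsDensity.isProbabilityMeasure_law {q : 𝒳 → ℝ≥0} (hq : IsDensity μ q) :
    IsProbabilityMeasure (law μ q) :=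
  ⟨by rw [law, withDensity_apply _ MeasurableSet.univ, Measure.restrict_univ, hq.2]⟩

theorem IsDensity.integrable {q : 𝒳 → ℝ≥0} (hq : IsDensity μ q) :
    Integrable (fun x => (q x : ℝ)) μ := by
  have := integrable_toReal_of_lintegral_ne_top (μ := μ) hq.1.coe_nnreal_ennreal.aemeasurable
    (by rw [hq.2]; exact ENNReal.one_ne_top)
  simpa using this

theorem IsDensity.integral_eq_one {q : 𝒳 → ℝ≥0} (hq : IsDensity μ q) :
    ∫ x, (q x : ℝ) ∂μ = 1 := by
  have := integral_toReal (μ := μ) hq.1.coe_nnreal_ennreal.aemeasurable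
    (Filter.Eventually.of_forall fun _ => ENNReal.coe_lt_top)
  rw [hq.2] at this
  simpa using this

theorem IsDensity.ae_law_ne_zero {q : 𝒳 → ℝ≥0} (hq : IsDensity μ q) :
    ∀ᵐ x ∂(law μ q), q x ≠ 0 := by
  rw [law, ae_withDensity_iff hq.1.coe_nnreal_ennreal]
  exact Filter.Eventually.of_forall fun x hx => by exact_mod_cast hx

/-- The part of f living where q vanishes is not seen by the law of q, hence an inequality. -/
theorem lintegral_law_div_le {q : 𝒳 → ℝ≥0} (hq : Measurable q) {f : 𝒳 → ℝ≥0∞}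
    (hf : Measurable f) : ∫⁻ x, f x / q x ∂(law μ q) ≤ ∫⁻ x, f x ∂μ := by
  have hm : Measurable fun x => f x / (q x : ℝ≥0∞) := hf.div hq.coe_nnreal_ennreal
  rw [law, lintegral_withDensity_eq_lintegral_mul _ hq.coe_nnreal_ennreal hm]
  exact lintegral_mono fun x => ENNReal.mul_div_le

theorem integrable_sqrt_mul {p q : 𝒳 → ℝ≥0} (hp : IsDensity μ p) (hq : IsDensity μ q) :
    Integrable (fun x => √(p x * q x : ℝ)) μ := by
  refine Integrable.mono' (hp.integrable.add hq.integrable)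
    (hp.1.coe_nnreal_real.mul hq.1.coe_nnreal_real).sqrt.aestronglyMeasurable
    (Filter.Eventually.of_forall fun x => ?_)
  rw [Real.norm_of_nonneg (Real.sqrt_nonneg _)]
  have h1 := (p x).coe_nonneg
  have h2 := (q x).coe_nonneg
  exact Real.sqrt_le_iff.2 ⟨add_nonneg h1 h2, by simp only [Pi.add_apply]; nlinarith⟩

theorem lintegral_sqrt_ratio_law {p q : 𝒳 → ℝ≥0} (hp : IsDensity μ p) (hq : IsDensity μ q) :
    ∫⁻ x, ENNReal.ofReal √((p x / q x : ℝ≥0) : ℝ) ∂(law μ q) =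
      ENNReal.ofReal (∫ x, √(p x * q x : ℝ) ∂μ) := by
  have hm : Measurable fun x => ENNReal.ofReal √((p x / q x : ℝ≥0) : ℝ) :=
    (hp.1.div hq.1).coe_nnreal_real.sqrt.ennreal_ofReal
  rw [law, lintegral_withDensity_eq_lintegral_mul _ hq.1.coe_nnreal_ennreal hm,
    ofReal_integral_eq_lintegral_ofReal (integrable_sqrt_mul hp hq)
      (Filter.Eventually.of_forall fun x => Real.sqrt_nonneg _)]
  refine lintegral_congr fun x => ?_
  rw [Pi.mul_apply, ← ENNReal.ofReal_coe_nnreal, ← ENNReal.ofReal_mul (q x).coe_nonneg]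
  congr 1
  rw [NNReal.coe_div, Real.sqrt_div (p x).coe_nonneg, Real.sqrt_mul (p x).coe_nonneg]
  rcases eq_or_ne (q x) 0 with h | h
  · simp [h]
  · have h1 : (0 : ℝ) < q x := by positivity
    have h2 := Real.mul_self_sqrt h1.le
    have h3 : 0 < √(q x : ℝ) := Real.sqrt_pos.2 h1
    field_simp
    linear_combination (-√(p x : ℝ)) * h2

/-- Comparison of the `L¹` distance with the Hellinger affinity. -/
theorem l1Dist_sq_le {p q : 𝒳 → ℝ≥0} (hp : IsDensity μ p) (hq : IsDensity μ q) :
    l1Dist μ p q ^ 2 / 2 ≤ 4 * (1 - ∫ x, √(p x * q x : ℝ) ∂μ) ∧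
      ∫ x, √(p x * q x : ℝ) ∂μ ≤ 1 := by
  have ip := hp.integrable
  have iq := hq.integrable
  have ia := integrable_sqrt_mul hp hq
  set a := ∫ x, √(p x * q x : ℝ) ∂μ with ha
  have hs : ∀ x, √(p x * q x : ℝ) = √(p x : ℝ) * √(q x : ℝ) :=
    fun x => Real.sqrt_mul (p x).coe_nonneg _
  have ipq : Integrable (fun x => (p x : ℝ) + q x) μ := ip.add iq
  have vpq : ∫ x, ((p x : ℝ) + q x) ∂μ = 2 := by
    rw [integral_add ip iq, hp.integral_eq_one, hq.integral_eq_one]; norm_num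
  have ha1 : a ≤ 1 := by
    have : ∫ x, 2 * √(p x * q x : ℝ) ∂μ ≤ ∫ x, ((p x : ℝ) + q x) ∂μ := by
      refine integral_mono (ia.const_mul 2) ipq fun x => ?_
      simp only [hs]
      nlinarith [sq_nonneg (√(p x : ℝ) - √(q x : ℝ)), Real.mul_self_sqrt (p x).coe_nonneg,
        Real.mul_self_sqrt (q x).coe_nonneg]
    rw [integral_const_mul, vpq] at this
    linarith
  refine ⟨?_, ha1⟩
  set l := l1Dist μ p q with hl
  have hl0 : 0 ≤ l := integral_nonneg fun x => abs_nonneg _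
  rcases hl0.eq_or_lt with h0 | hpos
  · rw [← h0]; linarith
  have i1 : Integrable (fun x => (p x : ℝ) + q x - 2 * √(p x * q x : ℝ)) μ :=
    ipq.sub (ia.const_mul 2)
  have i2 : Integrable (fun x => (p x : ℝ) + q x + 2 * √(p x * q x : ℝ)) μ :=
    ipq.add (ia.const_mul 2)
  -- AM-GM on |√p − √q|(√p + √q), in place of Cauchy-Schwarz. With these weights the second term
  -- contributes at most l/2, since the affinity is at most 1, and is absorbed on the left.
  have key : l ≤ ∫ x, (2 / l * ((p x : ℝ) + q x - 2 * √(p x * q x : ℝ))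
      + l / 8 * ((p x : ℝ) + q x + 2 * √(p x * q x : ℝ))) ∂μ := by
    refine integral_mono (ip.sub iq).abs ((i1.const_mul _).add (i2.const_mul _)) fun x => ?_
    simp only [hs]
    have e1 := Real.mul_self_sqrt (p x).coe_nonneg
    have e2 := Real.mul_self_sqrt (q x).coe_nonneg
    have s1 := Real.sqrt_nonneg (p x : ℝ)
    have s2 := Real.sqrt_nonneg (q x : ℝ)
    set u := √(p x : ℝ)
    set v := √(q x : ℝ)
    have f1 : (p x : ℝ) - q x = (u - v) * (u + v) := by linear_combination e2 - e1
    have f2 : (p x : ℝ) + q x - 2 * (u * v) = |u - v| ^ 2 := by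
      rw [sq_abs]; linear_combination -e1 - e2
    have f3 : (p x : ℝ) + q x + 2 * (u * v) = (u + v) ^ 2 := by linear_combination -e1 - e2
    rw [f1, f2, f3, abs_mul, abs_of_nonneg (add_nonneg s1 s2)]
    have : 2 / l * |u - v| ^ 2 + l / 8 * (u + v) ^ 2 - |u - v| * (u + v)
        = (4 * |u - v| - l * (u + v)) ^ 2 / (8 * l) := by
      field_simp; ring
    have h3 : 0 ≤ (4 * |u - v| - l * (u + v)) ^ 2 / (8 * l) := by positivity
    linarith
  rw [integral_add (i1.const_mul _) (i2.const_mul _), integral_const_mul, integral_const_mul,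
    integral_sub ipq (ia.const_mul 2), integral_add ipq (ia.const_mul 2), vpq,
    integral_const_mul, ← ha] at key
  have h5 : l * l ≤ (2 / l * (2 - 2 * a) + l / 8 * (2 + 2 * a)) * l :=
    mul_le_mul_of_nonneg_right key hl0
  have h6 : (2 / l * (2 - 2 * a) + l / 8 * (2 + 2 * a)) * l
      = 4 * (1 - a) + l * l * (1 + a) / 4 := by field_simp; ring
  have h7 : l * l * (1 + a) ≤ l * l * 2 :=
    mul_le_mul_of_nonneg_left (by linarith) (mul_self_nonneg l)
  nlinarith

/-- Finite Kullback-Leibler divergence expressed through the likelihood ratio. -/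
theorem log_ratio_of_kl_le [SigmaFinite μ] {p q : 𝒳 → ℝ≥0} (hp : IsDensity μ p)
    (hq : IsDensity μ q) {d : ℝ} (hd : (kl μ q p : EReal) ≤ (d : EReal)) :
    (∀ᵐ x ∂(law μ q), 0 < p x / q x) ∧
      Integrable (fun x => Real.log ((p x / q x : ℝ≥0) : ℝ)) (law μ q) ∧
      ∫ x, -Real.log ((p x / q x : ℝ≥0) : ℝ) ∂(law μ q) ≤ d := by
  have hP := hp.isProbabilityMeasure_law
  have hQ := hq.isProbabilityMeasure_law
  have hne : kl μ q p ≠ ∞ := fun h => by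
    rw [h, EReal.coe_ennreal_top, top_le_iff] at hd
    exact EReal.coe_ne_top d hd
  obtain ⟨hac, hint⟩ := klDiv_ne_top_iff.1 hne
  have hp0 : ∀ᵐ x ∂(law μ q), p x ≠ 0 := hac.ae_le hp.ae_law_ne_zero
  have hq0 := hq.ae_law_ne_zero
  have hm : Measurable fun x => (q x : ℝ≥0∞) / p x :=
    hq.1.coe_nnreal_ennreal.div hp.1.coe_nnreal_ennreal
  -- Absolute continuity forces p to be nonzero almost everywhere that q is, so the quotient is a
  -- genuine density and identifies the Radon-Nikodym derivative.
  have hlaw : law μ q = (law μ p).withDensity fun x => (q x : ℝ≥0∞) / p x := by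
    have h1 : ∀ᵐ x ∂μ, q x ≠ 0 → p x ≠ 0 := by
      rw [law, ae_withDensity_iff hq.1.coe_nnreal_ennreal] at hp0
      filter_upwards [hp0] with x hx h
      exact hx (by exact_mod_cast h)
    simp only [law]
    rw [← withDensity_mul _ hp.1.coe_nnreal_ennreal hm]
    refine withDensity_congr_ae ?_
    filter_upwards [h1] with x hx
    rw [Pi.mul_apply]
    rcases eq_or_ne (q x) 0 with h | h
    · simp [h]
    · exact (ENNReal.mul_div_cancel (by exact_mod_cast hx h) ENNReal.coe_ne_top).symm
  have hrn : ∀ᵐ x ∂(law μ q), (law μ q).rnDeriv (law μ p) x = (q x : ℝ≥0∞) / p x := by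
    refine hac.ae_le ?_
    have := Measure.rnDeriv_withDensity (law μ p) hm
    rwa [← hlaw] at this
  have hllr : llr (law μ q) (law μ p) =ᵐ[law μ q]
      fun x => -Real.log ((p x / q x : ℝ≥0) : ℝ) := by
    filter_upwards [hrn] with x hx
    rw [llr, hx, ENNReal.toReal_div, ENNReal.coe_toReal, ENNReal.coe_toReal, ← Real.log_inv,
      NNReal.coe_div, inv_div]
  refine ⟨?_, ?_, ?_⟩
  · filter_upwards [hp0, hq0] with x h1 h2
    exact div_pos (pos_iff_ne_zero.2 h1) (pos_iff_ne_zero.2 h2)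
  · have := ((integrable_congr hllr).1 hint).neg
    refine this.congr (Filter.Eventually.of_forall fun x => ?_)
    simp
  · rw [← integral_congr_ae hllr, ← toReal_klDiv_of_measure_eq hac (by simp)]
    have h0 : 0 ≤ d := by
      have : (0 : EReal) ≤ d := (EReal.coe_ennreal_nonneg _).trans hd
      exact_mod_cast this
    refine ENNReal.toReal_le_of_le_ofReal h0 ?_
    have h1 : (kl μ q p : EReal) ≤ ((ENNReal.ofReal d : ℝ≥0∞) : EReal) := by
      rwa [EReal.coe_ennreal_ofReal, max_eq_left h0]
    exact EReal.coe_ennreal_le_coe_ennreal_iff.1 h1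

variable [MeasurableSpace Γ]

/-- A supremum over an uncountable cell may fail to be measurable in x. The essential supremum under
the prior is measurable, and suffices because exceptional parameters are prior-null. -/
theorem measurable_essSup_left (π : Measure Γ) [SFinite π] {f : Γ → 𝒳 → ℝ≥0∞}
    (hf : Measurable (Function.uncurry f)) : Measurable fun x => essSup (fun θ => f θ x) π := by
  refine measurable_of_Iic fun c => ?_
  have h : (fun x => essSup (fun θ => f θ x) π) ⁻¹' Set.Iic c = {x | π {θ | c < f θ x} = 0} := by
    ext x
    simp only [Set.mem_preimage, Set.mem_Iic, Set.mem_ofPred_eq]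
    constructor
    · intro hx
      refine measure_mono_null (fun θ hθ => ?_) (ae_iff.1 (ENNReal.ae_le_essSup fun θ => f θ x))
      simp only [Set.mem_ofPred_eq, not_le] at hθ ⊢
      exact hx.trans_lt hθ
    · intro hx
      refine essSup_le_of_ae_le c ?_
      rw [Filter.EventuallyLE, ae_iff]
      simpa using hx
  rw [h]
  have hs : MeasurableSet {z : 𝒳 × Γ | c < f z.2 z.1} :=
    measurableSet_lt measurable_const (hf.comp measurable_swap)
  exact measurable_measure_prodMk_left hs (measurableSet_singleton 0)

/-- Provides a measurable set containing the Kullback-Leibler ball, with all that the evidence bound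
requires of its points. -/
theorem measurableSet_log_ratio (Q : Measure 𝒳) [IsProbabilityMeasure Q] {R : Γ → 𝒳 → ℝ≥0}
    (hR : Measurable (Function.uncurry R)) (d : ℝ) :
    MeasurableSet {θ | (∀ᵐ x ∂Q, 0 < R θ x) ∧ Integrable (fun x => Real.log (R θ x)) Q ∧
      ∫ x, -Real.log (R θ x) ∂Q ≤ d} := by
  have hl : Measurable (Function.uncurry fun θ x => Real.log (R θ x)) :=
    Real.measurable_log.comp hR.coe_nnreal_real
  have h1 : MeasurableSet {θ | ∀ᵐ x ∂Q, 0 < R θ x} := by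
    have hs : MeasurableSet {z : Γ × 𝒳 | ¬ 0 < R z.1 z.2} :=
      (measurableSet_lt (measurable_const (a := (0 : ℝ≥0))) hR).compl
    exact measurable_measure_prodMk_left hs (measurableSet_singleton 0)
  have h2 : MeasurableSet {θ | Integrable (fun x => Real.log (R θ x)) Q} :=
    measurableSet_integrable hl.stronglyMeasurable
  have h3 : Measurable fun θ => ∫ x, -Real.log (R θ x) ∂Q :=
    (hl.neg.stronglyMeasurable.integral_prod_right (ν := Q)).measurable
  exact h1.inter (h2.inter (measurableSet_le h3 measurable_const))

/-- The factor ∏ q(X_i) does not depend on θ and cancels between numerator and denominator. -/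
theorem posterior_apply (π : Measure Γ) {p : Γ → 𝒳 → ℝ≥0} (hp : Measurable (Function.uncurry p))
    {q : 𝒳 → ℝ≥0} {n : ℕ} {X : Fin n → 𝒳} (hX : ∀ i, q (X i) ≠ 0) {B : Set Γ}
    (hB : MeasurableSet B) :
    posterior π p X B = (∫⁻ θ in B, (∏ i, p θ (X i) / q (X i) : ℝ≥0) ∂π) /
      ∫⁻ θ, (∏ i, p θ (X i) / q (X i) : ℝ≥0) ∂π := by
  set c : ℝ≥0 := ∏ i, q (X i) with hc
  have hc0 : c ≠ 0 := Finset.prod_ne_zero_iff.2 fun i _ => hX i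
  have hlik : ∀ θ, likelihood p X θ = (c : ℝ≥0∞) * (∏ i, p θ (X i) / q (X i) : ℝ≥0) := by
    intro θ
    rw [likelihood, ← ENNReal.ofNNReal_finsetProd, ← ENNReal.coe_mul, hc, ← Finset.prod_mul_distrib]
    congr 1
    exact Finset.prod_congr rfl fun i _ => (mul_div_cancel₀ _ (hX i)).symm
  have hm : Measurable fun θ => ((∏ i, p θ (X i) / q (X i) : ℝ≥0) : ℝ≥0∞) :=
    (Finset.measurable_prod _ fun i _ =>
      hp.of_uncurry_right.div_const _).coe_nnreal_ennreal
  rw [posterior, withDensity_apply _ hB]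
  simp only [hlik, div_eq_mul_inv (a := (c : ℝ≥0∞) * _)]
  rw [lintegral_mul_const _ (hm.const_mul _), lintegral_const_mul _ hm, lintegral_const_mul _ hm,
    ← div_eq_mul_inv, ENNReal.mul_div_mul_left _ _ (by exact_mod_cast hc0) ENNReal.coe_ne_top]

theorem measurable_l1Dist [SFinite μ] {p : Γ → 𝒳 → ℝ≥0} (hp : Measurable (Function.uncurry p))
    {q : 𝒳 → ℝ≥0} (hq : Measurable q) : Measurable fun θ => l1Dist μ (p θ) q := by
  have : Measurable (Function.uncurry fun θ x => |(p θ x : ℝ) - q x|) :=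
    (hp.coe_nnreal_real.sub (hq.comp measurable_snd).coe_nnreal_real).abs
  exact (this.stronglyMeasurable.integral_prod_right (ν := μ)).measurable

end Densities

/-! ### From explicit radii to the critical radii -/

section Radii

variable {Γ 𝒳 : Type*} [MeasurableSpace Γ] [MeasurableSpace 𝒳]

theorem prob_posterior_gt_le_of_radii (μ : Measure 𝒳) [SigmaFinite μ]
    (π : Measure Γ) [IsProbabilityMeasure π] {p : Γ → 𝒳 → ℝ≥0}
    (hpm : Measurable (Function.uncurry p)) (hp : ∀ θ, IsDensity μ (p θ))
    {q : 𝒳 → ℝ≥0} (hq : IsDensity μ q) {n : ℕ} (hn : 1 ≤ n) {η h T d u : ℝ} (hη : 1 ≤ η)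
    (hh : 0 ≤ h) (hT : 0 ≤ T)
    (hd : ENNReal.ofReal (Real.exp (-d)) ≤ π {θ | (kl μ q (p θ) : EReal) ≤ (d : EReal)})
    {G : ℕ → Set Γ} (hGm : ∀ j, MeasurableSet (G j)) (hGU : ⋃ j, G j = Set.univ)
    (hG : ∑' j, π (G j) ^ ((η - 1) / (η - 1 / 2))
      * (∫⁻ x, ⨆ θ ∈ G j, (p θ x : ℝ≥0∞) ∂μ) ^ n ≤ ENNReal.ofReal (Real.exp (n * u))) :
    T / 8 * (Measure.pi fun _ : Fin n => law μ q).real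
      {X | ENNReal.ofReal (1 / (1 + Real.exp (n * h))) <
        posterior π p X {θ | T ≤ l1Dist μ (p θ) q ^ 2 / 2}} ≤
      η * h + (1 + 1 / n) * η * d + (η - 1 / 2) * u := by
  have hQ := hq.isProbabilityMeasure_law
  set Q := law μ q with hQdef
  set B : Set Γ := {θ | T ≤ l1Dist μ (p θ) q ^ 2 / 2} with hBdef
  have hB : MeasurableSet B :=
    measurableSet_le measurable_const (((measurable_l1Dist hpm hq.1).pow_const 2).div_const 2)
  set R : Γ → 𝒳 → ℝ≥0 := fun θ x => p θ x / q x with hRdef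
  have hR : Measurable (Function.uncurry R) := hpm.div (hq.1.comp measurable_snd)
  have hR1 : ∀ θ, ∫⁻ x, (R θ x : ℝ≥0∞) ∂Q ≤ 1 := fun θ => by
    rw [← (hp θ).2]
    refine le_trans (lintegral_mono fun x => ENNReal.coe_div_le)
      (lintegral_law_div_le hq.1 (hp θ).1.coe_nnreal_ennreal)
  set A : Set Γ := {θ | (∀ᵐ x ∂Q, 0 < R θ x) ∧ Integrable (fun x => Real.log (R θ x)) Q ∧
      ∫ x, -Real.log (R θ x) ∂Q ≤ d} with hAdef
  have hA : MeasurableSet A := measurableSet_log_ratio Q hR d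
  have hAd : ENNReal.ofReal (Real.exp (-d)) ≤ π A :=
    hd.trans (measure_mono fun θ hθ => log_ratio_of_kl_le (hp θ) hq hθ)
  have hS1 : ∀ θ, ∫⁻ x, ENNReal.ofReal √(R θ x) ∂Q ≤ 1 := fun θ => by
    rw [lintegral_sqrt_ratio_law (hp θ) hq]
    exact ENNReal.ofReal_le_one.2 (l1Dist_sq_le (hp θ) hq).2
  -- On B the affinity is at most 1 − T/4, hence at most e^{−T/4}; this is the origin of τ = T/4.
  have hSB : ∀ θ ∈ B, ∫⁻ x, ENNReal.ofReal √(R θ x) ∂Q ≤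
      ENNReal.ofReal (Real.exp (-(T / 4))) := fun θ hθ => by
    rw [lintegral_sqrt_ratio_law (hp θ) hq]
    refine ENNReal.ofReal_le_ofReal ?_
    have h1 := (l1Dist_sq_le (hp θ) hq).1
    have h2 := Real.add_one_le_exp (-(T / 4))
    have h3 : T ≤ l1Dist μ (p θ) q ^ 2 / 2 := hθ
    linarith
  -- The Gibbs inequality needs a partition. Shrinking the cells can only decrease the bracketing
  -- sum, because t ≥ 0.
  set D := disjointed G with hDdef
  have hDm : ∀ j, MeasurableSet (D j) := fun j => MeasurableSet.disjointed hGm j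
  have hDG : ∀ j, D j ⊆ G j := fun j => disjointed_subset G j
  set S : ℕ → 𝒳 → ℝ≥0∞ := fun j x => essSup (fun θ => (p θ x : ℝ≥0∞)) (π.restrict (D j)) with hS
  have hSm : ∀ j, Measurable (S j) := fun j => measurable_essSup_left _ hpm.coe_nnreal_ennreal
  have hSle : ∀ j x, S j x ≤ ⨆ θ ∈ G j, (p θ x : ℝ≥0∞) := fun j x => by
    refine essSup_le_of_ae_le _ ?_
    filter_upwards [ae_restrict_mem (hDm j)] with θ hθ
    exact le_iSup₂ (f := fun θ (_ : θ ∈ G j) => (p θ x : ℝ≥0∞)) θ (hDG j hθ)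
  set t := (η - 1) / (η - 1 / 2) with ht
  have hη2 : 0 < η - 1 / 2 := by linarith
  have ht0 : 0 ≤ t := div_nonneg (by linarith) hη2.le
  have ht1 : t ≤ 1 := (div_le_one hη2).2 (by linarith)
  have hU : ∑' j, π (D j) ^ t * (∫⁻ x, S j x / q x ∂Q) ^ n ≤
      ENNReal.ofReal (Real.exp (n * u)) := by
    refine le_trans (ENNReal.tsum_le_tsum fun j => ?_) hG
    have h1 : ∫⁻ x, S j x / q x ∂Q ≤ ∫⁻ x, ⨆ θ ∈ G j, (p θ x : ℝ≥0∞) ∂μ :=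
      (lintegral_law_div_le hq.1 (hSm j)).trans (lintegral_mono fun x => hSle j x)
    exact mul_le_mul' (ENNReal.rpow_le_rpow (measure_mono (hDG j)) ht0) (pow_le_pow_left' h1 n)
  obtain ⟨-, main⟩ := prob_posterior_gt_le Q hR hR1 π n hA hAd (fun θ hθ => hθ.1)
    (fun θ hθ => hθ.2.1) (fun θ hθ => hθ.2.2) hB (τ := T / 4) (by positivity) hS1 hSB hDm
    (disjoint_disjointed G) (by rw [hDdef, iUnion_disjointed, hGU])
    (U := fun j x => S j x / q x) (fun j => (hSm j).div hq.1.coe_nnreal_ennreal)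
    (fun j x => by
      filter_upwards [ENNReal.ae_le_essSup (μ := π.restrict (D j)) fun θ => (p θ x : ℝ≥0∞)]
        with θ hθ
      exact ENNReal.coe_div_le.trans (ENNReal.div_le_div_right hθ _))
    hη ht0 ht1 (mul_div_cancel₀ _ hη2.ne') hU (h := n * h) (by positivity)
  have hae : ∀ᵐ X ∂(Measure.pi fun _ : Fin n => Q), ∀ i, q (X i) ≠ 0 :=
    ae_all_iff.2 fun i => (measurePreserving_eval (fun _ : Fin n => Q) i).quasiMeasurePreserving.ae
      hq.ae_law_ne_zero
  have hEE : (Measure.pi fun _ : Fin n => Q).real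
      {X | ENNReal.ofReal (1 / (1 + Real.exp (n * h))) < posterior π p X B} =
      (Measure.pi fun _ : Fin n => Q).real {X | ENNReal.ofReal (1 / (1 + Real.exp (n * h))) <
        (∫⁻ θ in B, (∏ i, R θ (X i) : ℝ≥0) ∂π) / ∫⁻ θ, (∏ i, R θ (X i) : ℝ≥0) ∂π} := by
    refine measureReal_congr ?_
    filter_upwards [hae] with X hX
    have := posterior_apply π hpm hX hB
    exact congrArg (fun y => ENNReal.ofReal (1 / (1 + Real.exp (n * h))) < y) this
  rw [hEE]
  have hn0 : (0 : ℝ) < n := by exact_mod_cast hn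
  refine le_of_mul_le_mul_left ?_ hn0
  calc _ = n * (T / 4) / 2 * _ := by ring
    _ ≤ _ := main
    _ = _ := by field_simp

variable (μ : Measure 𝒳) (π : Measure Γ) (p : Γ → 𝒳 → ℝ≥0) (q : 𝒳 → ℝ≥0)

theorem priorMassRadius_nonneg [IsProbabilityMeasure π] : 0 ≤ priorMassRadius μ π p q := by
  refine le_iInf₂ fun d hd => le_trans ?_ hd
  rw [EReal.le_neg]
  simpa using prob_le_one

theorem exists_of_priorMassRadius_lt {d' : ℝ} (h : priorMassRadius μ π p q < d') :
    ∃ d : ℝ, d < d' ∧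
      ENNReal.ofReal (Real.exp (-d)) ≤ π {θ | (kl μ q (p θ) : EReal) ≤ (d : EReal)} := by
  obtain ⟨d, hd⟩ := iInf_lt_iff.1 h
  obtain ⟨hd1, hd2⟩ := iInf_lt_iff.1 hd
  refine ⟨d, by exact_mod_cast hd2, ?_⟩
  rw [← ENNReal.log_le_log_iff, ENNReal.log_ofReal_of_pos (Real.exp_pos _), Real.log_exp,
    EReal.coe_neg]
  exact EReal.neg_le.1 hd1

/-- A nonempty cell has bracket mass at least 1, and π(G)^s ≥ π(G) when s ≤ 1, so the sum dominates
Σ π(G_j) ≥ 1. Together with `priorMassRadius_nonneg` this rules out ⊤ + ⊥ in the threshold. -/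
theorem upperRadius_nonneg [IsProbabilityMeasure π] (hp : ∀ θ, IsDensity μ (p θ)) (n : ℕ)
    {s : ℝ} (hs : s ≤ 1) : 0 ≤ upperRadius μ π p n s := by
  refine le_iInf fun G => le_iInf fun hGm => le_iInf fun hGU => ?_
  refine EReal.mul_nonneg (by exact_mod_cast (by positivity : (0 : ℝ) ≤ 1 / n)) ?_
  rw [ENNReal.zero_le_log_iff]
  calc (1 : ℝ≥0∞) = π (⋃ j, G j) := by rw [hGU, measure_univ]
    _ ≤ ∑' j, π (G j) := measure_iUnion_le G
    _ ≤ _ := by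
      refine ENNReal.tsum_le_tsum fun j => ?_
      rcases (G j).eq_empty_or_nonempty with h | ⟨θ, hθ⟩
      · simp [h]
      · rw [one_add_upperBracketingRadius]
        have h1 : 1 ≤ ∫⁻ x, ⨆ θ ∈ G j, (p θ x : ℝ≥0∞) ∂μ := by
          rw [← (hp θ).2]
          exact lintegral_mono fun x =>
            le_iSup₂ (f := fun θ (_ : θ ∈ G j) => (p θ x : ℝ≥0∞)) θ hθ
        calc π (G j) = π (G j) ^ (1 : ℝ) * 1 := by simp
          _ ≤ _ := mul_le_mul' (ENNReal.rpow_le_rpow_of_exponent_ge prob_le_one hs)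
            (one_le_pow₀ h1)

theorem exists_of_upperRadius_lt {n : ℕ} (hn : 1 ≤ n) {s u : ℝ}
    (h : upperRadius μ π p n s < u) :
    ∃ G : ℕ → Set Γ, (∀ j, MeasurableSet (G j)) ∧ ⋃ j, G j = Set.univ ∧
      ∑' j, π (G j) ^ s * (∫⁻ x, ⨆ θ ∈ G j, (p θ x : ℝ≥0∞) ∂μ) ^ n ≤
        ENNReal.ofReal (Real.exp (n * u)) := by
  obtain ⟨G, h⟩ := iInf_lt_iff.1 h
  obtain ⟨hGm, h⟩ := iInf_lt_iff.1 h
  obtain ⟨hGU, h⟩ := iInf_lt_iff.1 h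
  refine ⟨G, hGm, hGU, ?_⟩
  simp only [one_add_upperBracketingRadius] at h
  by_contra! hc
  have hn0 : (0 : ℝ) < n := by exact_mod_cast hn
  rw [← ENNReal.log_lt_log_iff, ENNReal.log_ofReal_of_pos (Real.exp_pos _), Real.log_exp] at hc
  refine absurd h (not_lt.2 ?_)
  calc (u : EReal) = ((1 / n : ℝ) : EReal) * ((n * u : ℝ) : EReal) := by
        rw [← EReal.coe_mul]; congr 1; field_simp
    _ ≤ _ := mul_le_mul_of_nonneg_left hc.le (by exact_mod_cast (by positivity : (0 : ℝ) ≤ 1 / n))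

/-- The threshold is infinite unless both radii are finite, in which case it is a real number. -/
theorem threshold_eq_top_or [IsProbabilityMeasure π] (hp : ∀ θ, IsDensity μ (p θ)) {n : ℕ}
    {η h δ : ℝ} (hη : 1 ≤ η) (hδ : 0 < δ) :
    threshold μ π p q n η h δ = ⊤ ∨ ∃ x y : ℝ, priorMassRadius μ π p q = x ∧
      upperRadius μ π p n ((η - 1) / (η - 1 / 2)) = y ∧
      threshold μ π p q n η h δ =
        (((2 * ((1 + 1 / n) * η * x + (η - 1 / 2) * y) + (4 * η - 2) * h) / (δ / 4) : ℝ) :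
          EReal) := by
  have h2 : (2 : EReal) = ((2 : ℝ) : EReal) := rfl
  have hη2 : 0 < η - 1 / 2 := by linarith
  have hx := priorMassRadius_nonneg μ π p q
  have hy := upperRadius_nonneg μ π p hp n (s := (η - 1) / (η - 1 / 2))
    ((div_le_one hη2).2 (by linarith))
  have hc : 0 < (1 + 1 / (n : ℝ)) * η := by positivity
  have htop : ∀ e : EReal, e = ⊤ →
      (2 * e + (((4 * η - 2) * h : ℝ) : EReal)) / ((δ / 4 : ℝ) : EReal) = ⊤ := by
    rintro e rfl
    rw [h2, EReal.coe_mul_top_of_pos (by norm_num), EReal.top_add_of_ne_bot (EReal.coe_ne_bot _),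
      EReal.top_div_of_pos_ne_top (by exact_mod_cast (by positivity : 0 < δ / 4))
        (EReal.coe_ne_top _)]
  unfold threshold epsilonN
  generalize priorMassRadius μ π p q = x at *
  generalize upperRadius μ π p n ((η - 1) / (η - 1 / 2)) = y at *
  induction x with
  | bot => exact absurd hx (by simp)
  | top =>
    left
    refine htop _ ?_
    rw [EReal.coe_mul_top_of_pos hc, EReal.top_add_of_ne_bot]
    exact (lt_of_lt_of_le EReal.bot_lt_zero
      (EReal.mul_nonneg (by exact_mod_cast hη2.le) hy)).ne'
  | coe x =>
    induction y with
    | bot => exact absurd hy (by simp)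
    | top =>
      left
      refine htop _ ?_
      rw [EReal.coe_mul_top_of_pos hη2, ← EReal.coe_mul, EReal.add_top_of_ne_bot (EReal.coe_ne_bot _)]
    | coe y =>
      refine Or.inr ⟨x, y, rfl, rfl, ?_⟩
      rw [h2]
      simp only [← EReal.coe_mul, ← EReal.coe_add, ← EReal.coe_div]

theorem posterior_concentration [SigmaFinite μ] [IsProbabilityMeasure π]
    (hpm : Measurable (Function.uncurry p)) (hp : ∀ θ, IsDensity μ (p θ))
    (hq : IsDensity μ q) {n : ℕ} (hn : 1 ≤ n) {η h δ : ℝ} (hη : 1 ≤ η) (hh : 0 ≤ h)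
    (hδ : 0 < δ) (hδ1 : δ < 1) (hthr : 0 < threshold μ π p q n η h δ) :
    ENNReal.ofReal (1 - δ) ≤ Measure.pi (fun _ : Fin n => law μ q)
      {X | posterior π p X {θ | ((l1Dist μ (p θ) q ^ 2 / 2 : ℝ) : EReal)
        ≥ threshold μ π p q n η h δ} ≤ ENNReal.ofReal (1 / (1 + Real.exp (n * h)))} := by
  have hQ := hq.isProbabilityMeasure_law
  rcases threshold_eq_top_or μ π p q hp (n := n) (h := h) hη hδ with htop | ⟨x, y, hx, hy, hT⟩
  -- No real number reaches an infinite threshold, so the bad set is empty.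
  · simp [htop, hδ.le]
  rw [hT] at hthr ⊢
  set N := 2 * ((1 + 1 / (n : ℝ)) * η * x + (η - 1 / 2) * y) + (4 * η - 2) * h with hN
  have hT0 : 0 < N / (δ / 4) := by exact_mod_cast hthr
  have hN0 : 0 < N := (div_pos_iff_of_pos_right (by positivity)).1 hT0
  simp only [ge_iff_le, EReal.coe_le_coe_iff]
  set P := Measure.pi fun _ : Fin n => law μ q with hP
  set B : Set Γ := {θ | N / (δ / 4) ≤ l1Dist μ (p θ) q ^ 2 / 2} with hB
  set E := {X : Fin n → 𝒳 | ENNReal.ofReal (1 / (1 + Real.exp (n * h))) < posterior π p X B}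
    with hE
  have hβ : N / (δ / 4) / 8 * P.real E ≤
      η * h + (1 + 1 / n) * η * x + (η - 1 / 2) * y := by
    set a := (1 + 1 / (n : ℝ)) * η with ha
    have ha0 : 0 < a := by positivity
    have hg0 : 0 < η - 1 / 2 := by linarith
    -- The infima defining the radii need not be attained; both are exceeded by ε', scaled so that
    -- the total loss is ε.
    refine le_of_forall_pos_le_add fun ε hε => ?_
    set ε' := ε / (a + (η - 1 / 2)) with hε'
    have hε'0 : 0 < ε' := by positivity
    obtain ⟨d, hd, hdπ⟩ := exists_of_priorMassRadius_lt μ π p q (d' := x + ε')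
      (by rw [hx]; exact_mod_cast lt_add_of_pos_right x hε'0)
    obtain ⟨G, hGm, hGU, hG⟩ := exists_of_upperRadius_lt μ π p hn (u := y + ε')
      (by rw [hy]; exact_mod_cast lt_add_of_pos_right y hε'0)
    have h1 := prob_posterior_gt_le_of_radii μ π hpm hp hq hn hη hh hT0.le hdπ hGm hGU hG
    have h2 : a * d ≤ a * (x + ε') := by gcongr
    have h3 : (a + (η - 1 / 2)) * ε' = ε := mul_div_cancel₀ _ (by positivity)
    calc _ ≤ _ := h1
      _ ≤ η * h + a * (x + ε') + (η - 1 / 2) * (y + ε') := by linarith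
      _ = _ := by linear_combination h3
  have hβδ : P.real E ≤ δ := by
    -- Half of N is the critical radius plus (2η − 1)h, and η ≤ 2η − 1 since η ≥ 1.
    have h1 : η * h + (1 + 1 / n) * η * x + (η - 1 / 2) * y ≤ N / 2 := by
      rw [hN]; nlinarith
    have h2 : N / (δ / 4) / 8 * P.real E = N / 2 * (P.real E / δ) := by field_simp; ring
    have h3 : N / 2 * (P.real E / δ) ≤ N / 2 * 1 := by linarith
    exact (div_le_one hδ).1 (le_of_mul_le_mul_left h3 (by positivity))
  rw [ENNReal.ofReal_sub _ hδ.le, ENNReal.ofReal_one, tsub_le_iff_right]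
  calc (1 : ℝ≥0∞) = P Set.univ := measure_univ.symm
    _ ≤ P ({X | posterior π p X B ≤ ENNReal.ofReal (1 / (1 + Real.exp (n * h)))} ∪ E) :=
        measure_mono fun X _ => (le_or_gt (posterior π p X B) _ :)
    _ ≤ _ := measure_union_le _ _
    _ ≤ _ := by
        gcongr
        rw [← ENNReal.ofReal_toReal (measure_ne_top P E)]
        exact ENNReal.ofReal_le_ofReal hβδ

end Radii

end BayesDensity

theorem proposition4p2
    {S A Γ : Type*} [MeasurableSpace S] [MeasurableSpace Γ]
    (μ : Measure (S × ℝ)) [SigmaFinite μ]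
    (π : Measure Γ) [IsProbabilityMeasure π]
    (p : S → A → Γ → S × ℝ → ℝ≥0)
    (hp_meas : ∀ s a, Measurable (Function.uncurry (p s a)))
    (hp : ∀ s a θ, BayesDensity.IsDensity μ (p s a θ))
    (q : S → A → S × ℝ → ℝ≥0)
    (hq : ∀ s a, BayesDensity.IsDensity μ (q s a))
    (n : ℕ) (hn : 1 ≤ n) (η : ℝ) (hη : 1 ≤ η) :
    ∀ (s : S) (a : A) (h : ℝ) (δ : ℝ), 0 ≤ h → 0 < δ → δ < 1 →
      0 < BayesDensity.threshold μ π (p s a) (q s a) n η h δ →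
      Measure.pi (fun _ : Fin n => BayesDensity.law μ (q s a))
        {X | BayesDensity.posterior π (p s a) X
              {θ | ((BayesDensity.l1Dist μ (p s a θ) (q s a) ^ 2 / 2 : ℝ) : EReal)
                ≥ BayesDensity.threshold μ π (p s a) (q s a) n η h δ}
            ≤ ENNReal.ofReal (1 / (1 + Real.exp (n * h)))}
        ≥ ENNReal.ofReal (1 - δ) := by
  intro s a h δ hh hδ hδ1 hthr
  exact BayesDensity.posterior_concentration μ π (p s a) (q s a) (hp_meas s a) (hp s a) (hq s a)
    hn hη hh hδ hδ1 hthr
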